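/- Let $g \ge 2$ and let $\Sigma_g$ be the fundamental group of a closed Riemann surface of genus $g$. Up to homeomorphism, such a surface is the space obtained from the closed unit disc, with its boundary circle divided into $4g$ arcs of equal length, by gluing the arcs in pairs according to the boundary word $a_1 b_1 a_1^{-1} b_1^{-1} \cdots a_g b_g a_g^{-1} b_g^{-1}$; the base point is arbitrary. Let $p \ge 5$ be a prime. Then for every field $K$ of characteristic $p$ whose transcendence degree $r$ over $\mathbb{F}_p$ satisfies $r \ge 2$ ($r$ may be infinite), there exists an integer $n$ such that $\mathrm{GL}_n(K)$ contains a subgroup isomorphic to $\Sigma_g$. -/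

import Mathlib

noncomputable section

/-- The point of the closed unit disc of `ℂ` at position `s` along the boundary circle, where the
circle is divided into `4 * g` arcs of equal length and the `k`-th arc is traversed
counterclockwise as `s` runs from `k` to `k + 1`. -/
def boundaryPoint (g : ℕ) (s : ℝ) : Metric.closedBall (0 : ℂ) 1 :=
  ⟨Complex.exp ((2 * Real.pi * s / (4 * g) : ℝ) * Complex.I), by
    rw [mem_closedBall_zero_iff, Complex.norm_exp_ofReal_mul_I]⟩

/-- The side identifications of the `4 * g`-gon with boundary word
`a₁ b₁ a₁⁻¹ b₁⁻¹ ⋯ a_g b_g a_g⁻¹ b_g⁻¹`: for every `j < g`, arc `4 * j` is glued to arc `4 * j + 2`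
and arc `4 * j + 1` is glued to arc `4 * j + 3`, in both cases reversing the direction. -/
inductive SideGluing (g : ℕ) :
    Metric.closedBall (0 : ℂ) 1 → Metric.closedBall (0 : ℂ) 1 → Prop
  | a (j : Fin g) (t : unitInterval) :
      SideGluing g (boundaryPoint g (4 * (j : ℕ) + t)) (boundaryPoint g (4 * (j : ℕ) + 3 - t))
  | b (j : Fin g) (t : unitInterval) :
      SideGluing g (boundaryPoint g (4 * (j : ℕ) + 1 + t)) (boundaryPoint g (4 * (j : ℕ) + 4 - t))

/-- The standard closed orientable surface of genus `g ≥ 1`: the closed disc, regarded as a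
`4 * g`-gon, modulo the equivalence relation generated by the side identifications. -/
def StandardSurface (g : ℕ) : Type := Quot (SideGluing g)

/-- The quotient topology. -/
instance (g : ℕ) : TopologicalSpace (StandardSurface g) :=
  inferInstanceAs (TopologicalSpace (Quot (SideGluing g)))

/-- `X` is (the underlying topological space of) a closed orientable surface of genus `g`, for
`g ≥ 1`. -/
def IsClosedSurfaceOfGenus (g : ℕ) (X : Type*) [TopologicalSpace X] : Prop :=
  Nonempty (X ≃ₜ StandardSurface g)

/-! Let `F` be the free group on `x` and `y`. A Schottky representation of `F` in `GL₂`, suitably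
conjugated, is faithful, has entries in a field `L` of transcendence degree one, and makes the
commutator `⁅x, y⁆` diagonal. Only the powers of `⁅x, y⁆` have triangular image: if the image of `f`
is triangular, that of the commutator of `f` and `⁅x, y⁆` is unipotent, hence of finite order in
characteristic `p`, so `f` commutes with `⁅x, y⁆`. Therefore conjugating a second copy of the
representation by `diag (s, 1)` with `s` transcendental over `L` leaves the two copies in ping-pong
position over their common cyclic subgroup. This represents the double of `F` along `⁅x, y⁆`, which
is the surface group of genus two, faithfully over a field of transcendence degree two. A cyclic
cover of the surface of genus two embeds the surface group of any genus `g ≥ 2` in that double.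

The fundamental group of the glued polygon is computed without van Kampen's theorem. It is generated
by the loops crossing the sides, since every chart deforms onto a discrete set compatibly with the
gluing, and these loops satisfy the surface relation. The presented group acts on the fibre of the
covering space described by a locally constant cochain on the charts, and since the crossing loops
act by multiplication by the generators, no further relation holds.
-/

section Amalgam

open Monoid

variable {ι H Q : Type*} {G : ι → Type*} [Group H] [∀ i, Group (G i)] {φ : ∀ i, H →* G i}

/-- The factor `base φ c` on the right-hand side is absorbed by the leftmost letter of `w`; this is
what makes the induction work without any hypothesis on how `R (base φ c)` acts on the `P i`. -/
theorem map_base_mul_prod_mem_of_pingPong [Monoid Q]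
    (R : PushoutI φ →* Q) (P : ι → Set Q)
    (of_mem : ∀ i, ∀ g ∉ (φ i).range, R (PushoutI.of i g) ∈ P i)
    (of_mul_mem : ∀ i j, i ≠ j → ∀ g ∉ (φ i).range, ∀ A ∈ P j, R (PushoutI.of i g) * A ∈ P i)
    {d : PushoutI.NormalWord.Transversal φ} (w : PushoutI.NormalWord d) :
    (w.fstIdx = none → ∃ c, w.prod = PushoutI.base φ c) ∧
      ∀ i, w.fstIdx = some i → ∀ c, R (PushoutI.base φ c * w.prod) ∈ P i := by
  classical
  induction w using PushoutI.NormalWord.consRecOn with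
  | empty => exact ⟨fun _ => ⟨1, by simp⟩, fun i hi => nomatch hi⟩
  | base h w _ ih =>
    rw [PushoutI.NormalWord.prod_smul]
    refine ⟨fun hw => ?_, fun i hi c => ?_⟩
    · obtain ⟨c, hc⟩ := ih.1 hw
      exact ⟨h * c, by rw [hc, map_mul]⟩
    · rw [← mul_assoc, ← map_mul]
      exact ih.2 i hi (c * h)
  | cons i g w hw _ hg _ ih =>
    refine ⟨fun h => (nomatch h), fun j hj c => ?_⟩
    obtain rfl : i = j := by injection hj
    have hcg : φ i c * g ∉ (φ i).range := fun h =>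
      hg ((Subgroup.mul_mem_cancel_left _ (MonoidHom.mem_range.2 ⟨c, rfl⟩)).1 h)
    rw [PushoutI.NormalWord.prod_cons, ← mul_assoc, ← PushoutI.of_apply_eq_base φ i, ← map_mul]
    match hidx : w.fstIdx with
    | none =>
      obtain ⟨c', hc'⟩ := ih.1 hidx
      rw [hc', ← PushoutI.of_apply_eq_base φ i, ← map_mul]
      exact of_mem i _ fun h =>
        hcg ((Subgroup.mul_mem_cancel_right _ (MonoidHom.mem_range.2 ⟨c', rfl⟩)).1 h)
    | some j =>
      rw [map_mul]
      exact of_mul_mem i j (fun h => hw (h ▸ hidx)) _ hcg _ (by simpa using ih.2 j hidx 1)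

theorem injective_of_pingPong [Monoid Q] (R : PushoutI φ →* Q) (P : ι → Set Q)
    (base_injective : Function.Injective (R.comp (PushoutI.base φ)))
    (one_notMem : ∀ i, 1 ∉ P i)
    (of_mem : ∀ i, ∀ g ∉ (φ i).range, R (PushoutI.of i g) ∈ P i)
    (of_mul_mem : ∀ i j, i ≠ j → ∀ g ∉ (φ i).range, ∀ A ∈ P j, R (PushoutI.of i g) * A ∈ P i) :
    Function.Injective R := by
  classical
  have hφ (i : ι) : Function.Injective (φ i) := by
    rw [← PushoutI.of_comp_eq_base i] at base_injective
    exact Function.Injective.of_comp (f := R ∘ PushoutI.of i) base_injective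
  obtain ⟨d⟩ := PushoutI.NormalWord.transversal_nonempty φ hφ
  refine (injective_iff_map_eq_one R).2 fun x hx => ?_
  obtain ⟨w, rfl⟩ : ∃ w : PushoutI.NormalWord d, w.prod = x :=
    ⟨PushoutI.NormalWord.equiv x, PushoutI.NormalWord.equiv.left_inv x⟩
  have hw := map_base_mul_prod_mem_of_pingPong R P of_mem of_mul_mem w
  match hidx : w.fstIdx with
  | none =>
    obtain ⟨c, hc⟩ := hw.1 hidx
    have : c = 1 := base_injective (by simp [← hc, hx])
    rw [hc, this, map_one]
  | some i =>
    refine absurd ?_ (one_notMem i)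
    simpa [hx] using hw.2 i hidx 1

/-- The amalgamated product of two copies of `F`, indexed by `Fin 2`, along the subgroup `C`. -/
abbrev Double {F : Type*} [Group F] (C : Subgroup F) : Type _ :=
  PushoutI fun _ : Fin 2 => C.subtype

namespace Double

variable {F Q : Type*} [Group F] [Group Q] {C : Subgroup F}

/-- The homomorphism from the double of `F` along `C` given by two homomorphisms from `F` which
agree on `C`. -/
def lift (ρ : Fin 2 → F →* Q) (h : ∀ c ∈ C, ρ 1 c = ρ 0 c) : Double C →* Q :=
  PushoutI.lift ρ ((ρ 0).comp C.subtype) (by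
    rw [Fin.forall_fin_two]
    exact ⟨rfl, MonoidHom.ext fun c => h c c.2⟩)

@[simp]
theorem lift_of (ρ : Fin 2 → F →* Q) (h : ∀ c ∈ C, ρ 1 c = ρ 0 c) (i : Fin 2) (f : F) :
    lift ρ h (PushoutI.of i f) = ρ i f :=
  PushoutI.lift_of _ _ _ _

@[simp]
theorem lift_base (ρ : Fin 2 → F →* Q) (h : ∀ c ∈ C, ρ 1 c = ρ 0 c) (c : C) :
    lift ρ h (PushoutI.base _ c) = ρ 0 c :=
  PushoutI.lift_base _ _ _ _

end Double

end Amalgam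

section Doubling

open Matrix

/-- The invertible diagonal matrix `diag (s, 1)`. -/
def diagOne {L : Type*} [Field L] (s : Lˣ) : GL (Fin 2) L where
  val := !![s, 0; 0, 1]
  inv := !![s⁻¹, 0; 0, 1]
  val_inv := by ext i j; fin_cases i <;> fin_cases j <;> simp
  inv_val := by ext i j; fin_cases i <;> fin_cases j <;> simp

theorem val_diagOne {L : Type*} [Field L] (s : Lˣ) :
    (diagOne s).1 = !![(s : L), 0; 0, 1] :=
  rfl

theorem val_inv_diagOne {L : Type*} [Field L] (s : Lˣ) :
    (diagOne s)⁻¹.1 = !![(s : L)⁻¹, 0; 0, 1] :=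
  rfl

theorem val_conj_diagOne {L : Type*} [Field L] (s : Lˣ) (A : GL (Fin 2) L) :
    (MulAut.conj (diagOne s) A).1 = !![A 0 0, s * A 0 1; (s : L)⁻¹ * A 1 0, A 1 1] := by
  rw [MulAut.conj_apply, Units.val_mul, Units.val_mul, val_inv_diagOne, val_diagOne]
  ext i j
  fin_cases i <;> fin_cases j <;> simp [mul_apply, vecMul, dotProduct, Fin.sum_univ_two, mul_comm]

theorem conj_diagOne_mul_apply {L : Type*} [Field L] (s : Lˣ) (A B : GL (Fin 2) L) (j : Fin 2) :
    (MulAut.conj (diagOne s) A * B) 0 j = A 0 0 * B 0 j + s * A 0 1 * B 1 j ∧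
      (MulAut.conj (diagOne s) A * B) 1 j = (s : L)⁻¹ * A 1 0 * B 0 j + A 1 1 * B 1 j := by
  rw [Units.val_mul, val_conj_diagOne]
  constructor <;> exact (mul_apply ..).trans (Fin.sum_univ_two _)

/-- The subgroup of diagonal matrices. -/
def diagonalSubgroup (L : Type*) [Field L] : Subgroup (GL (Fin 2) L) where
  carrier := {A | A 0 1 = 0 ∧ A 1 0 = 0}
  one_mem' := by simp
  mul_mem' := by
    rintro A B ⟨hA01, hA10⟩ ⟨hB01, hB10⟩
    simp [mul_apply, Fin.sum_univ_two, hA01, hA10, hB01, hB10]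
  inv_mem' := by
    rintro A ⟨hA01, hA10⟩
    simp [coe_units_inv, inv_def, adjugate_fin_two, hA01, hA10]

theorem conj_diagOne_of_mem_diagonalSubgroup {L : Type*} [Field L] (s : Lˣ) {A : GL (Fin 2) L}
    (hA : A ∈ diagonalSubgroup L) : MulAut.conj (diagOne s) A = A := by
  apply Units.ext
  rw [val_conj_diagOne, hA.1, hA.2, mul_zero, mul_zero]
  exact (hA.1 ▸ hA.2 ▸ eta_fin_two A.1).symm

section Valuation

variable {M Γ : Type*} [Field M] [LinearOrderedCommGroupWithZero Γ] (v : Valuation M Γ)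

theorem valuation_mul_apply_one_of_lt {A B : Matrix (Fin 2) (Fin 2) M}
    (hA : ∀ i j, v (A i j) ≤ 1) (hA10 : v (A 1 0) = 1) {j : Fin 2} (hB : v (B 1 j) < v (B 0 j)) :
    v ((A * B) 1 j) = v (B 0 j) ∧ v ((A * B) 0 j) ≤ v ((A * B) 1 j) := by
  have h1 : v ((A * B) 1 j) = v (B 0 j) := by
    rw [mul_apply, Fin.sum_univ_two, Valuation.map_add_eq_of_lt_left] <;>
      simp only [map_mul, hA10, one_mul]
    exact (mul_le_of_le_one_left' (hA 1 1)).trans_lt hB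
  refine ⟨h1, ?_⟩
  rw [h1, mul_apply, Fin.sum_univ_two]
  refine v.map_add_le ?_ ?_ <;> rw [map_mul]
  · exact mul_le_of_le_one_left' (hA 0 0)
  · exact (mul_le_of_le_one_left' (hA 0 1)).trans hB.le

theorem one_lt_valuation_conj_mul_apply_zero {s : Mˣ} (hs : 1 < v s) {A : GL (Fin 2) M}
    (hA : ∀ i j, v (A i j) ≤ 1) (hA01 : v (A 0 1) = 1) {B : GL (Fin 2) M} {j : Fin 2}
    (hB1 : 1 ≤ v (B 1 j)) (hB : v (B 0 j) ≤ v (B 1 j)) :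
    1 < v ((MulAut.conj (diagOne s) A * B) 0 j) ∧
      v ((MulAut.conj (diagOne s) A * B) 1 j) < v ((MulAut.conj (diagOne s) A * B) 0 j) := by
  have hlt : v (B 1 j) < v s * v (B 1 j) :=
    lt_mul_of_one_lt_left (zero_lt_one.trans_le hB1) hs
  obtain ⟨entry0, entry1⟩ := conj_diagOne_mul_apply s A B j
  have h0 : v ((MulAut.conj (diagOne s) A * B) 0 j) = v s * v (B 1 j) := by
    rw [entry0, Valuation.map_add_eq_of_lt_right] <;> simp only [map_mul, hA01, mul_one]
    exact ((mul_le_of_le_one_left' (hA 0 0)).trans hB).trans_lt hlt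
  rw [h0]
  refine ⟨hB1.trans_lt hlt, lt_of_le_of_lt ?_ hlt⟩
  rw [entry1]
  refine v.map_add_le ?_ ?_ <;> simp only [map_mul, map_inv₀]
  · exact (mul_le_of_le_one_left'
      (mul_le_one' (inv_le_one_of_one_le₀ hs.le) (hA 1 0))).trans hB
  · exact mul_le_of_le_one_left' (hA 1 1)

end Valuation

theorem one_lt_inftyValuation_X (L : Type*) [Field L] [DecidableEq (RatFunc L)] :
    1 < RatFunc.inftyValuation L RatFunc.X := by
  rw [RatFunc.inftyValuation.X, ← WithZero.exp_zero, WithZero.exp_lt_exp]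
  exact zero_lt_one

namespace Double

variable {F M : Type*} [Group F] [Field M] {C : Subgroup F} {ρ : F →* GL (Fin 2) M}

/-- The representation of the double of `F` along `C` which is `ρ` on the first copy of `F` and `ρ`
conjugated by `diag (s, 1)`, which commutes with `ρ C`, on the second. -/
def twist (ρ : F →* GL (Fin 2) M) (hC : C ≤ (diagonalSubgroup M).comap ρ)
    (s : Mˣ) : Double C →* GL (Fin 2) M :=
  lift ![ρ, (MulAut.conj (diagOne s)).toMonoidHom.comp ρ]
    fun _ hc => conj_diagOne_of_mem_diagonalSubgroup s (hC hc)

@[simp]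
theorem twist_of_zero (hC : C ≤ (diagonalSubgroup M).comap ρ) (s : Mˣ) (f : F) :
    twist ρ hC s (Monoid.PushoutI.of 0 f) = ρ f :=
  lift_of _ _ 0 f

@[simp]
theorem twist_of_one (hC : C ≤ (diagonalSubgroup M).comap ρ) (s : Mˣ) (f : F) :
    twist ρ hC s (Monoid.PushoutI.of 1 f) = MulAut.conj (diagOne s) (ρ f) :=
  lift_of _ _ 1 f

theorem twist_injective {Γ : Type*} [LinearOrderedCommGroupWithZero Γ]
    (v : Valuation M Γ) (hρ : Function.Injective ρ)
    (hC : C ≤ (diagonalSubgroup M).comap ρ) (le_one : ∀ f i j, v (ρ f i j) ≤ 1)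
    (corner_eq_one : ∀ f ∉ C, v (ρ f 0 1) = 1 ∧ v (ρ f 1 0) = 1) {s : Mˣ} (hs : 1 < v s) :
    Function.Injective (twist ρ hC s) := by
  refine injective_of_pingPong (twist ρ hC s)
    ![{A | A ≠ 1 ∧ ∃ j, 1 ≤ v (A 1 j) ∧ v (A 0 j) ≤ v (A 1 j)},
      {A | ∃ j, 1 < v (A 0 j) ∧ v (A 1 j) < v (A 0 j)}] ?_ ?_ ?_ ?_
  · exact fun c c' h => Subtype.ext (hρ (by simpa [twist] using h))
  · simp [Fin.forall_fin_two]
  · simp only [Fin.forall_fin_two, Subgroup.range_subtype, twist_of_zero, twist_of_one]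
    refine ⟨fun f hf => ⟨fun h => ?_, 0, ?_⟩, fun f hf => ⟨1, ?_⟩⟩
    · simpa [h] using corner_eq_one f hf
    · simp [corner_eq_one f hf, le_one]
    · simpa using one_lt_valuation_conj_mul_apply_zero v hs (le_one f) (corner_eq_one f hf).1
        (B := 1) (j := 1) (by simp) (by simp)
  · simp only [Fin.forall_fin_two, Subgroup.range_subtype, twist_of_zero, twist_of_one]
    refine ⟨⟨fun h => absurd rfl h, fun _ f hf A ⟨j, hA, hlt⟩ => ?_⟩,
      ⟨fun _ f hf A ⟨_, j, hA, hle⟩ => ⟨j, ?_⟩, fun h => absurd rfl h⟩⟩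
    · obtain ⟨h1, h0⟩ := valuation_mul_apply_one_of_lt v (le_one f) (corner_eq_one f hf).2 hlt
      refine ⟨fun h => (h1 ▸ hA).not_ge ?_, j, h1 ▸ hA.le, h0⟩
      rw [← Units.val_mul, h]
      fin_cases j <;> simp
    · exact one_lt_valuation_conj_mul_apply_zero v hs (le_one f) (corner_eq_one f hf).1 hA hle

theorem exists_injective_ratFunc {L : Type*} [Field L] {ρ : F →* GL (Fin 2) L}
    (hρ : Function.Injective ρ) (hC : C ≤ (diagonalSubgroup L).comap ρ)
    (corner_ne_zero : ∀ f ∉ C, ρ f 0 1 ≠ 0 ∧ ρ f 1 0 ≠ 0) :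
    ∃ R : Double C →* GL (Fin 2) (RatFunc L), Function.Injective R := by
  classical
  let ρ' := (GeneralLinearGroup.map (n := Fin 2) (algebraMap L (RatFunc L))).comp ρ
  have hρ' (f : F) (i j : Fin 2) : ρ' f i j = algebraMap L (RatFunc L) (ρ f i j) := rfl
  have hC' : C ≤ (diagonalSubgroup (RatFunc L)).comap ρ' := fun c hc => by
    constructor <;> rw [hρ', map_eq_zero]
    exacts [(hC hc).1, (hC hc).2]
  let X : (RatFunc L)ˣ := Units.mk0 RatFunc.X RatFunc.X_ne_zero
  refine ⟨twist ρ' hC' X, twist_injective (RatFunc.inftyValuation L) (fun f f' h => hρ ?_) hC'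
    (fun f i j => Valuation.IsTrivialOn.valuation_algebraMap_le_one _ (ρ f i j))
    (fun f hf => ?_) (one_lt_inftyValuation_X L)⟩
  · ext i j
    exact (algebraMap L (RatFunc L)).injective (by rw [← hρ', ← hρ', h])
  · exact ⟨RatFunc.inftyValuation.C L (corner_ne_zero f hf).1,
      RatFunc.inftyValuation.C L (corner_ne_zero f hf).2⟩

end Double

end Doubling

open scoped commutatorElement

/-- The integral Heisenberg group, encoded so that `⟨x, y, z⟩` stands for the upper unitriangular
matrix with entries `x`, `y` next to the diagonal and `z` in the corner. It detects that the
commutator of two free generators is not a proper power. -/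
@[ext]
structure Heisenberg where
  x : ℤ
  y : ℤ
  z : ℤ

namespace Heisenberg

instance : Mul Heisenberg := ⟨fun a b => ⟨a.x + b.x, a.y + b.y, a.z + b.z + a.x * b.y⟩⟩
instance : One Heisenberg := ⟨⟨0, 0, 0⟩⟩
instance : Inv Heisenberg := ⟨fun a => ⟨-a.x, -a.y, -a.z + a.x * a.y⟩⟩

@[simp] theorem mul_x (a b : Heisenberg) : (a * b).x = a.x + b.x := rfl
@[simp] theorem mul_y (a b : Heisenberg) : (a * b).y = a.y + b.y := rfl
@[simp] theorem mul_z (a b : Heisenberg) : (a * b).z = a.z + b.z + a.x * b.y := rfl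
@[simp] theorem one_x : (1 : Heisenberg).x = 0 := rfl
@[simp] theorem one_y : (1 : Heisenberg).y = 0 := rfl
@[simp] theorem one_z : (1 : Heisenberg).z = 0 := rfl
@[simp] theorem inv_x (a : Heisenberg) : (a⁻¹).x = -a.x := rfl
@[simp] theorem inv_y (a : Heisenberg) : (a⁻¹).y = -a.y := rfl
@[simp] theorem inv_z (a : Heisenberg) : (a⁻¹).z = -a.z + a.x * a.y := rfl

instance : Group Heisenberg :=
  Group.ofLeftAxioms (by intros; ext <;> simp <;> ring) (by intros; ext <;> simp)
    (by intros; ext <;> simp)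

theorem zpow_x (a : Heisenberg) (k : ℤ) : (a ^ k).x = k * a.x := by
  induction k with
  | zero => simp
  | succ i ih => rw [zpow_add_one, mul_x, ih]; ring
  | pred i ih => rw [zpow_sub_one, mul_x, ih, inv_x]; ring

theorem zpow_z_of_x_eq_zero {a : Heisenberg} (hx : a.x = 0) (k : ℤ) : (a ^ k).z = k * a.z := by
  induction k with
  | zero => simp
  | succ i ih => rw [zpow_add_one, mul_z, ih, zpow_x, hx]; ring
  | pred i ih => rw [zpow_sub_one, mul_z, ih, zpow_x, inv_z, hx]; ring

theorem isUnit_of_zpow_eq_center {a : Heisenberg} {k : ℤ} (h : a ^ k = ⟨0, 0, 1⟩) :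
    IsUnit k := by
  have hk : k ≠ 0 := by
    rintro rfl
    simpa using congrArg z h
  have hx : a.x = 0 := by
    have := (zpow_x a k).symm.trans (congrArg x h)
    simpa [hk] using this
  exact IsUnit.of_mul_eq_one _ ((zpow_z_of_x_eq_zero hx k).symm.trans (congrArg z h))

/-- The homomorphism from a free group to the Heisenberg group which sends the generator `i` to
`⟨1, 0, 0⟩` and all other generators to `⟨0, 1, 0⟩`. -/
def ofFreeGroup {α : Type*} [DecidableEq α] (i : α) : FreeGroup α →* Heisenberg :=
  FreeGroup.lift fun k => if k = i then ⟨1, 0, 0⟩ else ⟨0, 1, 0⟩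

theorem ofFreeGroup_commutator {α : Type*} [DecidableEq α] {i j : α} (hij : i ≠ j) :
    ofFreeGroup i ⁅FreeGroup.of i, FreeGroup.of j⁆ = ⟨0, 0, 1⟩ := by
  ext <;> simp [ofFreeGroup, commutatorElement_def, hij.symm]

end Heisenberg

section FreeGroup

theorem isCyclic_of_commute {G : Type*} [Group G] [IsFreeGroup G]
    (h : ∀ a b : G, Commute a b) : IsCyclic G := by
  classical
  have hsub : Subsingleton (IsFreeGroup.Generators G) := ⟨fun i j => by
    by_contra hij
    have hcomm : Commute (FreeGroup.of i) (FreeGroup.of j) := by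
      simpa using (h (IsFreeGroup.mulEquiv G (.of i)) (IsFreeGroup.mulEquiv G (.of j))).map
        (IsFreeGroup.mulEquiv G).symm
    have := Heisenberg.ofFreeGroup_commutator hij
    rw [commutatorElement_eq_one_iff_commute.2 hcomm, map_one] at this
    simpa using congrArg Heisenberg.z this⟩
  refine (IsFreeGroup.mulEquiv G).isCyclic.1 ?_
  obtain hempty | ⟨⟨i⟩⟩ := isEmpty_or_nonempty (IsFreeGroup.Generators G)
  · infer_instance
  · have := uniqueOfSubsingleton i
    infer_instance

theorem exists_mem_zpowers_of_commute {G : Type*} [Group G] [IsFreeGroup G] {x y : G}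
    (h : Commute x y) : ∃ z : G, x ∈ Subgroup.zpowers z ∧ y ∈ Subgroup.zpowers z := by
  have hcomm : IsMulCommutative (Subgroup.closure {x, y}) :=
    Subgroup.isMulCommutative_closure (by
      rintro a (rfl | rfl) b (rfl | rfl)
      exacts [rfl, h, h.symm, rfl])
  obtain ⟨z, hz⟩ := (isCyclic_of_commute (G := Subgroup.closure {x, y})
    hcomm.is_comm.comm).exists_generator
  have mem_zpowers (a : G) (ha : a ∈ Subgroup.closure {x, y}) : a ∈ Subgroup.zpowers (z : G) := by
    obtain ⟨k, hk⟩ := Subgroup.mem_zpowers_iff.1 (hz ⟨a, ha⟩)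
    exact Subgroup.mem_zpowers_iff.2 ⟨k, by simpa using congrArg Subtype.val hk⟩
  exact ⟨z, mem_zpowers x (Subgroup.subset_closure (by simp)),
    mem_zpowers y (Subgroup.subset_closure (by simp))⟩

/-- The commutator of the two generators of a free group of rank two; the amalgamated subgroup of
the double `FreeDouble` is generated by it. -/
def freeCommutator : FreeGroup Bool :=
  ⁅FreeGroup.of false, FreeGroup.of true⁆

theorem mem_zpowers_freeCommutator_of_commute {f : FreeGroup Bool}
    (h : Commute f freeCommutator) : f ∈ Subgroup.zpowers freeCommutator := by
  obtain ⟨z, hf, hc⟩ := exists_mem_zpowers_of_commute h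
  obtain ⟨k, hk⟩ := Subgroup.mem_zpowers_iff.1 hc
  have hk_unit : IsUnit k := Heisenberg.isUnit_of_zpow_eq_center
    (a := Heisenberg.ofFreeGroup false z)
    (by rw [← map_zpow, hk, freeCommutator, Heisenberg.ofFreeGroup_commutator Bool.false_ne_true])
  have hz : z ∈ Subgroup.zpowers freeCommutator := by
    obtain rfl | rfl := Int.isUnit_iff.1 hk_unit <;> simp [← hk]
  exact Subgroup.zpowers_le.2 hz hf

end FreeGroup

section Unipotent

open Matrix

theorem pow_char_eq_one_of_sub_one_sq_eq_zero {R : Type*} [Ring R] (p : ℕ) [Fact p.Prime]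
    [CharP R p] {A : R} (hA : (A - 1) ^ 2 = 0) : A ^ p = 1 := by
  rw [← sub_add_cancel A 1, add_pow_char_of_commute p (Commute.one_right _), one_pow,
    pow_eq_zero_of_le (Fact.out : p.Prime).two_le hA, zero_add]

theorem trace_commutator_of_mem_diagonalSubgroup {L : Type*} [Field L] {A B : GL (Fin 2) L}
    (hA : A 0 1 = 0 ∨ A 1 0 = 0) (hB : B ∈ diagonalSubgroup L) : ⁅A, B⁆.1.trace = 2 := by
  obtain ⟨hB01, hB10⟩ := hB
  have hdetA := A.det_ne_zero
  have hdetB := B.det_ne_zero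
  have hdet_mul : A 0 1 * A 1 0 = 0 := mul_eq_zero.2 hA
  rw [det_fin_two, hdet_mul, sub_zero, mul_ne_zero_iff] at hdetA
  rw [det_fin_two, hB01, zero_mul, sub_zero, mul_ne_zero_iff] at hdetB
  obtain ⟨hA0, hA1⟩ := hdetA
  obtain ⟨hB0, hB1⟩ := hdetB
  simp only [commutatorElement_def, Units.val_mul, coe_units_inv, inv_def, adjugate_fin_two,
    trace_fin_two, mul_apply, Fin.sum_univ_two, det_fin_two, hB01, hB10, hdet_mul]
  simp only [mul_zero, add_zero, sub_zero, zero_add, Ring.inverse_eq_inv', _root_.mul_inv_rev,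
    Matrix.smul_apply, of_apply, cons_val', cons_val_zero, cons_val_one, cons_val_fin_one,
    smul_eq_mul, mul_neg, neg_zero]
  field_simp
  linear_combination (-B 1 1 ^ 2 - B 0 0 ^ 2) * hdet_mul

theorem commutator_sub_one_sq_eq_zero {L : Type*} [Field L] {A B : GL (Fin 2) L}
    (hA : A 0 1 = 0 ∨ A 1 0 = 0) (hB : B ∈ diagonalSubgroup L) : (⁅A, B⁆.1 - 1) ^ 2 = 0 := by
  have htrace := trace_commutator_of_mem_diagonalSubgroup hA hB
  have hdet : ⁅A, B⁆.1.det = 1 := by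
    rw [← GeneralLinearGroup.val_det_apply, map_commutatorElement,
      commutatorElement_eq_one_iff_commute.2 (Commute.all _ _), Units.val_one]
  have cayley_hamilton := aeval_self_charpoly ⁅A, B⁆.1
  simp only [charpoly_fin_two, htrace, hdet, map_one, map_add, Polynomial.aeval_sub, map_pow,
    Polynomial.aeval_X, map_mul, map_ofNat] at cayley_hamilton
  rw [← cayley_hamilton, (Commute.one_right ⁅A, B⁆.1).sub_sq, mul_one, one_pow]

theorem mem_zpowers_freeCommutator_of_corner_eq_zero {L : Type*} [Field L] (p : ℕ)
    [Fact p.Prime] [CharP L p] {ρ : FreeGroup Bool →* GL (Fin 2) L} (hρ : Function.Injective ρ)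
    (hdiag : ρ freeCommutator ∈ diagonalSubgroup L) {f : FreeGroup Bool}
    (hf : ρ f 0 1 = 0 ∨ ρ f 1 0 = 0) : f ∈ Subgroup.zpowers freeCommutator := by
  refine mem_zpowers_freeCommutator_of_commute (commutatorElement_eq_one_iff_commute.1 ?_)
  have hpow : ⁅f, freeCommutator⁆ ^ p = 1 := hρ <| Units.ext <| by
    rw [map_pow, map_commutatorElement, map_one]
    exact pow_char_eq_one_of_sub_one_sq_eq_zero p (commutator_sub_one_sq_eq_zero hf hdiag)
  exact (pow_eq_one_iff_left (Fact.out : p.Prime).ne_zero).1 hpow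

end Unipotent

section Schottky

open Matrix
open scoped Pointwise

/-- `G` and `Bool` have to live in the same universe in `FreeGroup.injective_lift_of_ping_pong`. -/
theorem injective_lift_conj_of_pingPong {G : Type} {α : Type*} [Group G] [MulAction G α] {d h : G}
    {U V : Set α} (hU : U.Nonempty) (hUV : Disjoint U V) (hd : d • Vᶜ ⊆ U) (hd' : d⁻¹ • Uᶜ ⊆ V)
    (hh : Disjoint (h • (U ∪ V)) (U ∪ V)) :
    Function.Injective (FreeGroup.lift (bif · then h * d * h⁻¹ else d)) := by
  simp only [Set.smul_set_union, Set.disjoint_union_left, Set.disjoint_union_right] at hh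
  obtain ⟨⟨hUU, hVU⟩, hUV', hVV⟩ := hh
  refine FreeGroup.injective_lift_of_ping_pong _ (bif · then h • U else U)
    (bif · then h • V else V) ?_ ?_ ?_ ?_ ?_ ?_
  · rintro (_ | _)
    exacts [hU, hU.smul_set]
  · rintro (_ | _) (_ | _) hne
    exacts [absurd rfl hne, hUU.symm, hUU, absurd rfl hne]
  · rintro (_ | _) (_ | _) hne
    exacts [absurd rfl hne, hVV.symm, hVV, absurd rfl hne]
  · rintro (_ | _) (_ | _)
    exacts [hUV, hVU.symm, hUV', Set.disjoint_smul_set.2 hUV]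
  · rintro (_ | _)
    · exact hd
    · simpa [← Set.smul_set_compl, mul_smul] using hd
  · rintro (_ | _)
    · exact hd'
    · simpa [← Set.smul_set_compl, mul_smul, mul_assoc] using hd'

section Representation

variable {L : Type*} [Field L]

/-- The invertible matrix with columns `(1, 1)` and `(1, -1)`. -/
def hadamardMatrix (h2 : (2 : L) ≠ 0) : GL (Fin 2) L where
  val := !![1, 1; 1, -1]
  inv := !![2⁻¹, 2⁻¹; 2⁻¹, -2⁻¹]
  val_inv := by
    ext i j; fin_cases i <;> fin_cases j <;> simp <;> field_simp <;> norm_num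
  inv_val := by
    ext i j; fin_cases i <;> fin_cases j <;> simp <;> field_simp <;> norm_num

theorem val_hadamardMatrix (h2 : (2 : L) ≠ 0) : (hadamardMatrix h2).1 = !![1, 1; 1, -1] :=
  rfl

theorem val_inv_hadamardMatrix (h2 : (2 : L) ≠ 0) :
    (hadamardMatrix h2)⁻¹.1 = !![2⁻¹, 2⁻¹; 2⁻¹, -2⁻¹] :=
  rfl

/-- The homomorphism sending the generators of the free group to `diag (t, 1)` and its conjugate
by the Hadamard matrix. -/
def schottky (h2 : (2 : L) ≠ 0) (t : Lˣ) : FreeGroup Bool →* GL (Fin 2) L :=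
  FreeGroup.lift (bif · then hadamardMatrix h2 * diagOne t * (hadamardMatrix h2)⁻¹ else diagOne t)

theorem first_column_ne_zero (B : GL (Fin 2) L) : B 0 0 ≠ 0 ∨ B 1 0 ≠ 0 := by
  by_contra! h
  exact B.det_ne_zero (by rw [det_fin_two, h.1, h.2, zero_mul, mul_zero, sub_zero])

theorem diagOne_mul_apply (t : Lˣ) (B : GL (Fin 2) L) :
    (diagOne t * B) 0 0 = t * B 0 0 ∧ (diagOne t * B) 1 0 = B 1 0 := by
  rw [Units.val_mul, val_diagOne]
  constructor <;> simp [vecMul, dotProduct, Fin.sum_univ_two]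

theorem diagOne_inv_mul_apply (t : Lˣ) (B : GL (Fin 2) L) :
    ((diagOne t)⁻¹ * B) 0 0 = (t : L)⁻¹ * B 0 0 ∧ ((diagOne t)⁻¹ * B) 1 0 = B 1 0 := by
  rw [Units.val_mul, val_inv_diagOne]
  constructor <;> simp [vecMul, dotProduct, Fin.sum_univ_two]

theorem hadamardMatrix_mul_apply (h2 : (2 : L) ≠ 0) (B : GL (Fin 2) L) :
    (hadamardMatrix h2 * B) 0 0 = B 0 0 + B 1 0 ∧ (hadamardMatrix h2 * B) 1 0 = B 0 0 - B 1 0 := by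
  rw [Units.val_mul, val_hadamardMatrix]
  constructor <;> simp [vecMul, dotProduct, Fin.sum_univ_two, sub_eq_add_neg]

theorem schottky_freeCommutator (h2 : (2 : L) ≠ 0) (t : Lˣ) :
    (schottky h2 t freeCommutator).1 =
      (4 * (t : L) ^ 2)⁻¹ •
        (!![t * (t + 1) ^ 2 - t ^ 2 * (t - 1) ^ 2, t * (t + 1) * (t - 1) ^ 2;
          -((t + 1) * (t - 1) ^ 2), t * (t + 1) ^ 2 - (t - 1) ^ 2] : Matrix (Fin 2) (Fin 2) L) := by
  have ht : (t : L) ≠ 0 := t.ne_zero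
  have h4 : (4 : L) ≠ 0 := by
    rw [show (4 : L) = 2 * 2 by norm_num]
    exact mul_ne_zero h2 h2
  have hcomm : schottky h2 t freeCommutator = diagOne t *
      (hadamardMatrix h2 * diagOne t * (hadamardMatrix h2)⁻¹) * (diagOne t)⁻¹ *
      (hadamardMatrix h2 * (diagOne t)⁻¹ * (hadamardMatrix h2)⁻¹) := by
    simp [schottky, freeCommutator, commutatorElement_def, mul_assoc]
  rw [hcomm]
  simp only [Units.val_mul, val_diagOne, val_inv_diagOne, val_hadamardMatrix,
    val_inv_hadamardMatrix]
  ext i j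
  fin_cases i <;> fin_cases j <;> simp <;> field_simp <;> ring

theorem discr_schottky_freeCommutator (h2 : (2 : L) ≠ 0) {t : Lˣ} {w : L}
    (hw : w ^ 2 = (t : L) ^ 2 - 6 * t + 1) :
    (schottky h2 t freeCommutator).1.discr =
      ((t - 1) ^ 2 * (t + 1) * w / (4 * (t : L) ^ 2)) ^ 2 := by
  have ht : (t : L) ≠ 0 := t.ne_zero
  have h4 : (4 : L) ≠ 0 := by
    rw [show (4 : L) = 2 * 2 by norm_num]
    exact mul_ne_zero h2 h2
  rw [div_pow, mul_pow, hw, schottky_freeCommutator, discr_fin_two, trace_smul, det_smul,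
    trace_fin_two_of, det_fin_two_of, smul_eq_mul, Fintype.card_fin]
  field_simp
  ring

theorem exists_conj_mem_diagonalSubgroup {A : GL (Fin 2) L} (h2 : (2 : L) ≠ 0) (hA : A 1 0 ≠ 0)
    {d : L} (hd : d ≠ 0) (discr_eq : A.1.discr = d ^ 2) :
    ∃ P : GL (Fin 2) L, MulAut.conj P A ∈ diagonalSubgroup L := by
  -- The columns of `P` are eigenvectors of `A`, by the quadratic formula.
  let P : GL (Fin 2) L := GeneralLinearGroup.mkOfDetNeZero
    !![A 0 0 - A 1 1 + d, A 0 0 - A 1 1 - d; 2 * A 1 0, 2 * A 1 0] (by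
      rw [det_fin_two_of]
      convert mul_ne_zero (mul_ne_zero (mul_ne_zero h2 h2) hA) hd using 1
      ring)
  have hP : P.1 = !![A 0 0 - A 1 1 + d, A 0 0 - A 1 1 - d; 2 * A 1 0, 2 * A 1 0] := rfl
  rw [discr_fin_two, trace_fin_two, det_fin_two] at discr_eq
  refine ⟨P⁻¹, ?_, ?_⟩ <;>
    rw [MulAut.conj_apply, inv_inv, Units.val_mul, Units.val_mul, coe_units_inv, inv_def,
      adjugate_fin_two, hP] <;>
    simp only [mul_apply, Fin.sum_univ_two, det_fin_two_of, Ring.inverse_eq_inv', of_apply,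
      cons_val', cons_val_one, cons_val_fin_one, cons_val_zero, neg_sub, Matrix.smul_apply,
      smul_eq_mul]
  · linear_combination A 1 0 * (4 * A 1 0 * d)⁻¹ * discr_eq
  · linear_combination -A 1 0 * (4 * A 1 0 * d)⁻¹ * discr_eq

end Representation

section Valuation

variable {Γ : Type*} [LinearOrderedCommGroupWithZero Γ]

theorem schottky_injective {L : Type} [Field L] (v : Valuation L Γ) (h2 : (2 : L) ≠ 0) {t : Lˣ}
    (ht : 1 < v t) : Function.Injective (schottky h2 t) := by
  have pos_of_le {x y : L} (hx : x ≠ 0 ∨ y ≠ 0) (h : v x ≤ v y) : 0 < v y := by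
    rw [Valuation.pos_iff]
    rintro rfl
    simp_all
  refine injective_lift_conj_of_pingPong (α := GL (Fin 2) L) (U := {B | v (B 1 0) < v (B 0 0)})
    (V := {B | v (B 0 0) < v (B 1 0)}) ⟨1, by simp⟩ ?_ ?_ ?_ ?_
  · exact Set.disjoint_left.2 fun B hU hV => lt_asymm hU hV
  · rintro _ ⟨B, hB, rfl⟩
    have hle : v (B 1 0) ≤ v (B 0 0) := not_lt.1 hB
    change v ((diagOne t * B) 1 0) < v ((diagOne t * B) 0 0)
    rw [(diagOne_mul_apply t B).1, (diagOne_mul_apply t B).2, map_mul]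
    exact hle.trans_lt
      (lt_mul_of_one_lt_left (pos_of_le (first_column_ne_zero B).symm hle) ht)
  · rintro _ ⟨B, hB, rfl⟩
    have hle : v (B 0 0) ≤ v (B 1 0) := not_lt.1 hB
    change v (((diagOne t)⁻¹ * B) 0 0) < v (((diagOne t)⁻¹ * B) 1 0)
    rw [(diagOne_inv_mul_apply t B).1, (diagOne_inv_mul_apply t B).2, map_mul, map_inv₀]
    exact (mul_le_mul_right hle _).trans_lt
      (mul_lt_of_lt_one_left (pos_of_le (first_column_ne_zero B) hle) (inv_lt_one_of_one_lt₀ ht))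
  · refine Set.disjoint_left.2 ?_
    rintro _ ⟨B, hB, rfl⟩
    have hv : v (B 0 0 + B 1 0) = v (B 0 0 - B 1 0) := by
      obtain h | h := hB
      · rw [Valuation.map_add_eq_of_lt_left v h, Valuation.map_sub_eq_of_lt_left v h]
      · rw [Valuation.map_add_eq_of_lt_right v h, Valuation.map_sub_eq_of_lt_right v h]
    simp [-Units.val_mul, hadamardMatrix_mul_apply, hv]

theorem exists_injective_freeCommutator_mem_diagonalSubgroup {L : Type} [Field L]
    (v : Valuation L Γ) (h2 : (2 : L) ≠ 0) {t w : L} (ht : 1 < v t) (hw : w ≠ 0)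
    (htw : w ^ 2 = t ^ 2 - 6 * t + 1) :
    ∃ ρ : FreeGroup Bool →* GL (Fin 2) L, Function.Injective ρ ∧
      ρ freeCommutator ∈ diagonalSubgroup L := by
  have ne_of_valuation {x : L} (hx : v x ≤ 1) : t - x ≠ 0 := sub_ne_zero.2 <| by
    rintro rfl
    exact hx.not_gt ht
  have ht0 : t ≠ 0 := by simpa using ne_of_valuation (x := 0) (by simp)
  have ht1 : t - 1 ≠ 0 := ne_of_valuation (by simp)
  have ht2 : t + 1 ≠ 0 := by simpa using ne_of_valuation (x := -1) (by simp)
  have h4 : (4 : L) ≠ 0 := by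
    rw [show (4 : L) = 2 * 2 by norm_num]
    exact mul_ne_zero h2 h2
  lift t to Lˣ using ht0.isUnit
  obtain ⟨P, hP⟩ := exists_conj_mem_diagonalSubgroup (A := schottky h2 t freeCommutator)
    (d := (t - 1) ^ 2 * (t + 1) * w / (4 * (t : L) ^ 2)) h2 (by
      simp [schottky_freeCommutator, h4, ht1, ht2])
    (by simp [h4, ht1, ht2, hw]) (discr_schottky_freeCommutator h2 htw)
  exact ⟨(MulAut.conj P).toMonoidHom.comp (schottky h2 t),
    (MulAut.conj P).injective.comp (schottky_injective v h2 ht), hP⟩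

end Valuation

/-- The double of the free group of rank two along the commutator of its generators, that is, the
fundamental group of the closed surface of genus two. -/
abbrev FreeDouble : Type :=
  Double (Subgroup.zpowers freeCommutator)

theorem exists_injective_ratFunc_freeCommutator_mem_diagonalSubgroup {F : Type} [Field F]
    (h2 : (2 : F) ≠ 0) :
    ∃ ρ : FreeGroup Bool →* GL (Fin 2) (RatFunc F), Function.Injective ρ ∧
      ρ freeCommutator ∈ diagonalSubgroup (RatFunc F) := by
  classical
  let v := RatFunc.inftyValuation F
  let X : RatFunc F := RatFunc.X
  have hX : X ≠ 0 := RatFunc.X_ne_zero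
  have one_lt_X : 1 < v X := one_lt_inftyValuation_X F
  have inv_lt_one : v X⁻¹ < 1 := by
    rw [map_inv₀]
    exact inv_lt_one_of_one_lt₀ one_lt_X
  have valuation_two_mul : v (2 * X) = v X := by
    have := RatFunc.inftyValuation.C F h2
    rw [map_mul, ← map_ofNat RatFunc.C, this, one_mul]
  have valuation_three : v 3 ≤ 1 := by
    simpa only [map_ofNat] using Valuation.IsTrivialOn.valuation_algebraMap_le_one v (3 : F)
  have valuation_add : v (3 + X⁻¹) ≤ 1 := v.map_add_le valuation_three inv_lt_one.le
  -- `2 * X + (3 + X⁻¹)` and `2 * X - X⁻¹` parametrize the conic `w ^ 2 = t ^ 2 - 6 * t + 1`.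
  refine exists_injective_freeCommutator_mem_diagonalSubgroup v (t := 2 * X + (3 + X⁻¹))
    (w := 2 * X - X⁻¹) ?_ ?_ ?_ ?_
  · rw [← map_ofNat RatFunc.C]
    exact (map_ne_zero _).2 h2
  · rwa [Valuation.map_add_eq_of_lt_left, valuation_two_mul]
    rw [valuation_two_mul]
    exact valuation_add.trans_lt one_lt_X
  · intro h
    rw [← sub_eq_zero.1 h, valuation_two_mul] at inv_lt_one
    exact lt_asymm inv_lt_one one_lt_X
  · field_simp
    ring

theorem exists_freeDouble_injective_ratFunc_ratFunc (p : ℕ) [Fact p.Prime] (hp : p ≠ 2) (F : Type)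
    [Field F] [CharP F p] :
    ∃ R : FreeDouble →* GL (Fin 2) (RatFunc (RatFunc F)), Function.Injective R := by
  obtain ⟨ρ, hρ, hdiag⟩ := exists_injective_ratFunc_freeCommutator_mem_diagonalSubgroup
    (Ring.two_ne_zero (R := F) (ringChar.eq F p ▸ hp))
  have : CharP (RatFunc F) p :=
    charP_of_injective_algebraMap (algebraMap F (RatFunc F)).injective p
  exact Double.exists_injective_ratFunc hρ (Subgroup.zpowers_le.2 hdiag) fun f hf =>
    not_or.1 fun h => hf (mem_zpowers_freeCommutator_of_corner_eq_zero p hρ hdiag h)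

end Schottky

section SurfaceGroup

section CommutatorProd

variable {Γ Δ : Type*} [Group Γ] [Group Δ]

/-- The product of commutators `⁅a 0, b 0⁆ * ⁅a 1, b 1⁆ * ⋯ * ⁅a (k - 1), b (k - 1)⁆`. -/
def commutatorProd (a b : ℕ → Γ) : ℕ → Γ
  | 0 => 1
  | k + 1 => commutatorProd a b k * ⁅a k, b k⁆

@[simp]
theorem commutatorProd_zero (a b : ℕ → Γ) : commutatorProd a b 0 = 1 :=
  rfl

theorem commutatorProd_succ (a b : ℕ → Γ) (k : ℕ) :
    commutatorProd a b (k + 1) = commutatorProd a b k * ⁅a k, b k⁆ :=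
  rfl

theorem map_commutatorProd (φ : Γ →* Δ) (a b : ℕ → Γ) (k : ℕ) :
    φ (commutatorProd a b k) = commutatorProd (φ ∘ a) (φ ∘ b) k := by
  induction k with
  | zero => simp
  | succ k ih => simp [commutatorProd_succ, ih, map_commutatorElement]

theorem commutatorProd_congr {a b a' b' : ℕ → Γ} {k : ℕ} (ha : ∀ i < k, a i = a' i)
    (hb : ∀ i < k, b i = b' i) : commutatorProd a b k = commutatorProd a' b' k := by
  induction k with
  | zero => rfl
  | succ k ih =>
    rw [commutatorProd_succ, commutatorProd_succ, ih (fun i hi => ha i (hi.trans k.lt_succ_self))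
      (fun i hi => hb i (hi.trans k.lt_succ_self)), ha k k.lt_succ_self, hb k k.lt_succ_self]

theorem commutatorProd_conj_pow {a₁ b₁ a₂ b₂ : Γ} (h : ⁅a₂, b₂⁆ = ⁅b₁, a₁⁆) (k : ℕ) :
    commutatorProd (fun i => MulAut.conj (a₁ ^ i) a₂) (fun i => MulAut.conj (a₁ ^ i) b₂) k =
      ⁅b₁, a₁ ^ k⁆ := by
  induction k with
  | zero => simp
  | succ k ih =>
    rw [commutatorProd_succ, ih, ← map_commutatorElement, h, pow_succ']
    simp only [commutatorElement_def, MulAut.conj_apply]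
    group

/-- In a cyclic cover of degree `n + 1` of a surface of genus two the second handle lifts to `n + 1`
handles, and the first one to a single handle which is wrapped `n + 1` times around. -/
theorem commutatorProd_cyclicCover {a₁ b₁ a₂ b₂ : Γ} (h : ⁅a₂, b₂⁆ = ⁅b₁, a₁⁆) (n : ℕ) :
    commutatorProd (fun i => if i < n + 1 then MulAut.conj (a₁ ^ i) a₂ else a₁ ^ (n + 1))
      (fun i => if i < n + 1 then MulAut.conj (a₁ ^ i) b₂ else b₁) (n + 2) = 1 := by
  rw [commutatorProd_succ, commutatorProd_congr (a' := fun i => MulAut.conj (a₁ ^ i) a₂)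
    (b' := fun i => MulAut.conj (a₁ ^ i) b₂) (fun i hi => if_pos hi) (fun i hi => if_pos hi),
    commutatorProd_conj_pow h, if_neg (lt_irrefl _), if_neg (lt_irrefl _), ← commutatorElement_inv,
    inv_mul_cancel]

end CommutatorProd

/-- The defining relator of `SurfaceGroup g`. Families indexed by `Fin g` are extended by one to
families indexed by `ℕ`. -/
noncomputable def surfaceRelator (g : ℕ) : FreeGroup (Fin g × Bool) :=
  commutatorProd (Function.extend Fin.val (fun j => FreeGroup.of (j, false)) 1)
    (Function.extend Fin.val (fun j => FreeGroup.of (j, true)) 1) g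

/-- The group with generators `a j`, `b j` for `j < g`, encoded as `(j, false)` and `(j, true)`, and
with the product of the commutators of `a j` and `b j` as its only relator. -/
abbrev SurfaceGroup (g : ℕ) : Type :=
  PresentedGroup {surfaceRelator g}

namespace SurfaceGroup

variable {g : ℕ}

/-- The generators `a j`, which are `1` by convention for `g ≤ j`. -/
noncomputable def a (g : ℕ) : ℕ → SurfaceGroup g :=
  Function.extend Fin.val (fun j => PresentedGroup.of (j, false)) 1

/-- The generators `b j`, which are `1` by convention for `g ≤ j`. -/
noncomputable def b (g : ℕ) : ℕ → SurfaceGroup g :=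
  Function.extend Fin.val (fun j => PresentedGroup.of (j, true)) 1

theorem a_val (j : Fin g) : a g j = PresentedGroup.of (j, false) :=
  Fin.val_injective.extend_apply _ _ _

theorem b_val (j : Fin g) : b g j = PresentedGroup.of (j, true) :=
  Fin.val_injective.extend_apply _ _ _

theorem map_surfaceRelator {Γ : Type*} [Group Γ] (φ : FreeGroup (Fin g × Bool) →* Γ) {x y : ℕ → Γ}
    (hx : ∀ j : Fin g, φ (.of (j, false)) = x j) (hy : ∀ j : Fin g, φ (.of (j, true)) = y j) :
    φ (surfaceRelator g) = commutatorProd x y g := by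
  rw [surfaceRelator, map_commutatorProd]
  refine commutatorProd_congr (fun i hi => ?_) (fun i hi => ?_) <;> lift i to Fin g using hi
  · rw [Function.comp_apply, Fin.val_injective.extend_apply, hx]
  · rw [Function.comp_apply, Fin.val_injective.extend_apply, hy]

theorem commutatorProd_eq_one (g : ℕ) : commutatorProd (a g) (b g) g = 1 := by
  rw [← map_surfaceRelator (PresentedGroup.mk _) (fun j => (a_val j).symm)
    (fun j => (b_val j).symm)]
  exact PresentedGroup.one_of_mem rfl

/-- The homomorphism from the surface group sending `a j` to `x j` and `b j` to `y j`. -/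
def lift {Γ : Type*} [Group Γ] (x y : ℕ → Γ) (h : commutatorProd x y g = 1) :
    SurfaceGroup g →* Γ :=
  PresentedGroup.toGroup (f := fun i => bif i.2 then y i.1 else x i.1) (by
    rintro _ rfl
    rw [map_surfaceRelator (x := x) (y := y) _ (by simp) (by simp), h])

@[simp]
theorem lift_a {Γ : Type*} [Group Γ] (x y : ℕ → Γ) (h : commutatorProd x y g = 1) (j : Fin g) :
    lift x y h (a g j) = x j := by
  rw [a_val, lift, PresentedGroup.toGroup.of, cond_false]

@[simp]
theorem lift_b {Γ : Type*} [Group Γ] (x y : ℕ → Γ) (h : commutatorProd x y g = 1) (j : Fin g) :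
    lift x y h (b g j) = y j := by
  rw [b_val, lift, PresentedGroup.toGroup.of, cond_true]

theorem closure_range_generators (g : ℕ) :
    Subgroup.closure (Set.range fun i : Fin g × Bool => bif i.2 then b g i.1 else a g i.1) = ⊤ := by
  rw [← PresentedGroup.closure_range_of]
  congr 2
  ext ⟨j, _ | _⟩
  exacts [a_val j, b_val j]

end SurfaceGroup

namespace FreeDouble

variable {Q : Type*} [Group Q]

/-- The first free generator of the `i`-th copy of the free group. -/
def x (i : Fin 2) : FreeDouble :=
  Monoid.PushoutI.of i (FreeGroup.of false)

/-- The second free generator of the `i`-th copy of the free group. -/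
def y (i : Fin 2) : FreeDouble :=
  Monoid.PushoutI.of i (FreeGroup.of true)

theorem commutator_x_y (i : Fin 2) :
    ⁅x i, y i⁆ = Monoid.PushoutI.base _ ⟨freeCommutator, Subgroup.mem_zpowers _⟩ := by
  rw [← Monoid.PushoutI.of_apply_eq_base _ i, commutatorElement_def, x, y]
  simp only [← map_mul, ← map_inv]
  rfl

theorem commutator_y_x_eq (i j : Fin 2) : ⁅y i, x i⁆ = ⁅y j, x j⁆ := by
  rw [← commutatorElement_inv, ← commutatorElement_inv (x j), commutator_x_y, commutator_x_y]

/-- The homomorphism from the double of the free group sending `x i` to `u i` and `y i` to `v i`. -/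
def lift (u v : Fin 2 → Q) (h : ⁅u 1, v 1⁆ = ⁅u 0, v 0⁆) : FreeDouble →* Q :=
  Double.lift (fun i => FreeGroup.lift (bif · then v i else u i)) fun c hc => by
    obtain ⟨k, rfl⟩ := Subgroup.mem_zpowers_iff.1 hc
    simp [freeCommutator, map_commutatorElement, h]

@[simp]
theorem lift_x (u v : Fin 2 → Q) (h : ⁅u 1, v 1⁆ = ⁅u 0, v 0⁆) (i : Fin 2) :
    lift u v h (x i) = u i := by
  simp [lift, x]

@[simp]
theorem lift_y (u v : Fin 2 → Q) (h : ⁅u 1, v 1⁆ = ⁅u 0, v 0⁆) (i : Fin 2) :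
    lift u v h (y i) = v i := by
  simp [lift, y]

end FreeDouble

section CyclicCover

variable {G : Type*} [Group G] {n : ℕ}

/-- The permutation of `Fin (n + 1) × G` translating the fibre over `i` by `d i`. -/
def fibrePerm (d : Fin (n + 1) → G) : Equiv.Perm (Fin (n + 1) × G) where
  toFun x := (x.1, d x.1 * x.2)
  invFun x := (x.1, (d x.1)⁻¹ * x.2)
  left_inv x := by simp
  right_inv x := by simp

theorem fibrePerm_apply (d : Fin (n + 1) → G) (x : Fin (n + 1) × G) :
    fibrePerm d x = (x.1, d x.1 * x.2) :=
  rfl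

theorem fibrePerm_inv (d : Fin (n + 1) → G) : (fibrePerm d)⁻¹ = fibrePerm d⁻¹ :=
  Equiv.ext fun _ => rfl

/-- The permutation of `Fin (n + 1) × G` shifting the first coordinate down, and translating by
`c` when wrapping around. -/
def shiftPerm (n : ℕ) (c : G) : Equiv.Perm (Fin (n + 1) × G) where
  toFun x := Fin.cases (Fin.last n, c * x.2) (fun j => (j.castSucc, x.2)) x.1
  invFun x := Fin.lastCases (0, c⁻¹ * x.2) (fun j => (j.succ, x.2)) x.1
  left_inv := by
    rintro ⟨i, h⟩
    cases i using Fin.cases <;> simp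
  right_inv := by
    rintro ⟨i, h⟩
    cases i using Fin.lastCases <;> simp

theorem shiftPerm_zero (c h : G) : shiftPerm n c (0, h) = (Fin.last n, c * h) :=
  rfl

theorem shiftPerm_succ (c h : G) (j : Fin n) : shiftPerm n c (j.succ, h) = (j.castSucc, h) :=
  rfl

theorem shiftPerm_inv_last (c h : G) : (shiftPerm n c)⁻¹ (Fin.last n, h) = (0, c⁻¹ * h) := by
  rw [Equiv.Perm.inv_eq_iff_eq, shiftPerm_zero, mul_inv_cancel_left]

theorem shiftPerm_inv_castSucc (c h : G) (j : Fin n) :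
    (shiftPerm n c)⁻¹ (j.castSucc, h) = (j.succ, h) := by
  rw [Equiv.Perm.inv_eq_iff_eq, shiftPerm_succ]

theorem shiftPerm_pow_apply (c h : G) (k : Fin (n + 1)) :
    (shiftPerm n c ^ (k : ℕ)) (k, h) = (0, h) := by
  induction k using Fin.induction with
  | zero => rfl
  | succ k ih =>
    rw [Fin.val_succ, pow_succ, Equiv.Perm.mul_apply, shiftPerm_succ]
    exact ih

theorem conj_shiftPerm_pow_fibrePerm_apply (c h : G) (d : Fin (n + 1) → G) (k : Fin (n + 1)) :
    MulAut.conj (shiftPerm n c ^ (k : ℕ)) (fibrePerm d) (0, h) = (0, d k * h) := by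
  have hinv : (shiftPerm n c ^ (k : ℕ))⁻¹ (0, h) = (k, h) :=
    Equiv.Perm.inv_eq_iff_eq.2 (shiftPerm_pow_apply c h k).symm
  rw [MulAut.conj_apply, Equiv.Perm.mul_apply, Equiv.Perm.mul_apply, hinv, fibrePerm_apply,
    shiftPerm_pow_apply]

/-- The translations along `b (n + 1)` are corrected by the partial products of the relator so that
the relation of genus two holds in every fibre; in the last fibre this is the relation of genus
`n + 2`. -/
theorem commutator_fibrePerm_eq_commutator_shiftPerm {a b : ℕ → G}
    (h : commutatorProd a b (n + 2) = 1) :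
    ⁅fibrePerm fun i : Fin (n + 1) => b i, fibrePerm fun i : Fin (n + 1) => a i⁆ =
      ⁅shiftPerm n (a (n + 1)),
        fibrePerm fun i : Fin (n + 1) => (commutatorProd a b i)⁻¹ * b (n + 1)⁆ := by
  have hlast (x : G) : a (n + 1) * (b (n + 1) * ((a (n + 1))⁻¹ * x)) =
      (commutatorProd a b (n + 1))⁻¹ * b (n + 1) * x := by
    rw [← mul_assoc, ← mul_assoc, mul_left_inj, ← mul_inv_eq_iff_eq_mul, ← commutatorElement_def]
    exact (inv_eq_of_mul_eq_one_right h).symm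
  rw [commutatorElement_def, commutatorElement_def (shiftPerm _ _), eq_mul_inv_iff_mul_eq]
  ext1 ⟨i, x⟩
  simp only [fibrePerm_inv, Equiv.Perm.mul_apply, fibrePerm_apply, Pi.inv_apply]
  cases i using Fin.lastCases with
  | last =>
    simp only [Fin.val_last, shiftPerm_inv_last, shiftPerm_zero, Fin.val_zero,
      commutatorProd_zero, inv_one, one_mul]
    rw [hlast, commutatorProd_succ, commutatorElement_def]
    group
  | cast j =>
    simp only [Fin.val_castSucc, shiftPerm_inv_castSucc, shiftPerm_succ,
      Fin.val_succ, commutatorProd_succ, commutatorElement_def]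
    group

theorem injective_of_perm_apply_eq {H X : Type*} [Group H] (θ : G →* H) (Ψ : H →* Equiv.Perm X)
    {f : G → X} (hf : Function.Injective f) {s : Set G} (hs : Subgroup.closure s = ⊤)
    (h : ∀ x ∈ s, ∀ y, Ψ (θ x) (f y) = f (x * y)) : Function.Injective θ := by
  have apply_eq (x : G) : ∀ y, Ψ (θ x) (f y) = f (x * y) := by
    induction hs ▸ Subgroup.mem_top x using Subgroup.closure_induction with
    | mem x hx => exact h x hx
    | one => simp
    | mul x z _ _ hx hz => simp [hz, hx, mul_assoc]
    | inv x _ hx =>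
      intro y
      rw [map_inv, map_inv, Equiv.Perm.inv_eq_iff_eq, hx, mul_inv_cancel_left]
  refine (injective_iff_map_eq_one θ).2 fun x hx => hf ?_
  rw [← mul_one x, ← apply_eq, hx, map_one, Equiv.Perm.one_apply]

theorem exists_surfaceGroup_injective_freeDouble (n : ℕ) :
    ∃ θ : SurfaceGroup (n + 2) →* FreeDouble, Function.Injective θ := by
  let A := SurfaceGroup.a (n + 2)
  let B := SurfaceGroup.b (n + 2)
  let Ψ : FreeDouble →* Equiv.Perm (Fin (n + 1) × SurfaceGroup (n + 2)) := FreeDouble.lift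
    ![shiftPerm n (A (n + 1)), fibrePerm fun i => B i]
    ![fibrePerm fun i => (commutatorProd A B i)⁻¹ * B (n + 1), fibrePerm fun i => A i]
    (commutator_fibrePerm_eq_commutator_shiftPerm (SurfaceGroup.commutatorProd_eq_one (n + 2)))
  have Ψ_x₀ : Ψ (FreeDouble.x 0) = shiftPerm n (A (n + 1)) := FreeDouble.lift_x _ _ _ 0
  have Ψ_x₁ : Ψ (FreeDouble.x 1) = fibrePerm fun i => B i := FreeDouble.lift_x _ _ _ 1
  have Ψ_y₀ : Ψ (FreeDouble.y 0) = fibrePerm fun i => (commutatorProd A B i)⁻¹ * B (n + 1) :=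
    FreeDouble.lift_y _ _ _ 0
  have Ψ_y₁ : Ψ (FreeDouble.y 1) = fibrePerm fun i => A i := FreeDouble.lift_y _ _ _ 1
  have Ψ_conj (i : Fin (n + 1)) (z : FreeDouble) :
      Ψ (MulAut.conj (FreeDouble.x 0 ^ (i : ℕ)) z) =
        MulAut.conj (shiftPerm n (A (n + 1)) ^ (i : ℕ)) (Ψ z) := by
    rw [MulAut.conj_apply, map_mul, map_mul, map_inv, map_pow, Ψ_x₀, MulAut.conj_apply]
  refine ⟨SurfaceGroup.lift _ _ (commutatorProd_cyclicCover (FreeDouble.commutator_y_x_eq 1 0) n),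
    injective_of_perm_apply_eq _ Ψ (Prod.mk_right_injective 0)
      (SurfaceGroup.closure_range_generators _) ?_⟩
  rintro _ ⟨⟨i, _ | _⟩, rfl⟩ z
  · change Ψ (SurfaceGroup.lift _ _ _ (A i)) _ = (0, A i * z)
    rw [SurfaceGroup.lift_a]
    cases i using Fin.lastCases with
    | last =>
      rw [Fin.val_last, if_neg (lt_irrefl _), map_pow, Ψ_x₀, pow_succ,
        Equiv.Perm.mul_apply, shiftPerm_zero]
      exact shiftPerm_pow_apply (A (n + 1)) (A (n + 1) * z) (Fin.last n)
    | cast i =>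
      rw [Fin.val_castSucc, if_pos i.2, Ψ_conj, Ψ_y₁]
      exact conj_shiftPerm_pow_fibrePerm_apply _ _ _ i
  · change Ψ (SurfaceGroup.lift _ _ _ (B i)) _ = (0, B i * z)
    rw [SurfaceGroup.lift_b]
    cases i using Fin.lastCases with
    | last =>
      rw [Fin.val_last, if_neg (lt_irrefl _), Ψ_y₀, fibrePerm_apply,
        Fin.val_zero, commutatorProd_zero, inv_one, one_mul]
    | cast i =>
      rw [Fin.val_castSucc, if_pos i.2, Ψ_conj, Ψ_x₁]
      exact conj_shiftPerm_pow_fibrePerm_apply _ _ _ i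

end CyclicCover

end SurfaceGroup

open IntermediateField in
theorem exists_ringHom_ratFunc_ratFunc {F K : Type*} [Field F] [Field K] [Algebra F K]
    (h : 2 ≤ Algebra.trdeg F K) : Nonempty (RatFunc (RatFunc F) →+* K) := by
  obtain ⟨ι, x, hx⟩ := exists_isTranscendenceBasis' F K
  obtain ⟨i, j, hij⟩ : ∃ i j : ι, i ≠ j := by
    rwa [← hx.cardinalMk_eq_trdeg, Cardinal.two_le_iff] at h
  have hj : Transcendental F⟮x i⟯ (x j) := by
    rw [IntermediateField.transcendental_adjoin_iff]
    have := hx.1.transcendental_adjoin (Set.notMem_singleton_iff.2 hij.symm)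
    rwa [Set.image_singleton] at this
  let eᵢ := RatFunc.algEquivOfTranscendental (x i) (hx.1.transcendental i)
  let eⱼ := RatFunc.algEquivOfTranscendental (x j) hj
  let m : RatFunc (RatFunc F) →+* RatFunc F⟮x i⟯ :=
    RatFunc.mapRingHom (Polynomial.mapRingHom (eᵢ : RatFunc F →+* F⟮x i⟯))
      (nonZeroDivisors_le_comap_nonZeroDivisors_of_injective _
        (Polynomial.map_injective _ eᵢ.injective))
  exact ⟨(algebraMap F⟮x i⟯⟮x j⟯ K).comp ((eⱼ : RatFunc F⟮x i⟯ →+* F⟮x i⟯⟮x j⟯).comp m)⟩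

theorem exists_surfaceGroup_injective_GL (p : ℕ) [Fact p.Prime] (hp : p ≠ 2) {g : ℕ} (hg : 2 ≤ g)
    (K : Type*) [Field K] [Algebra (ZMod p) K] (hK : 2 ≤ Algebra.trdeg (ZMod p) K) :
    ∃ R : SurfaceGroup g →* GL (Fin 2) K, Function.Injective R := by
  obtain ⟨n, rfl⟩ := Nat.exists_eq_add_of_le' hg
  obtain ⟨θ, hθ⟩ := exists_surfaceGroup_injective_freeDouble n
  obtain ⟨R, hR⟩ := exists_freeDouble_injective_ratFunc_ratFunc p hp (ZMod p)
  obtain ⟨ι⟩ := exists_ringHom_ratFunc_ratFunc hK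
  exact ⟨((Matrix.GeneralLinearGroup.map ι).comp R).comp θ,
    ((Units.map_injective (Matrix.map_injective ι.injective)).comp hR).comp hθ⟩

section Gluing

open CategoryTheory Topology unitInterval

universe u v

variable {D E ι : Type*} {X : Type u} [TopologicalSpace D] [TopologicalSpace X]

/-- The map `q` exhibits `X` as the quotient of `D` by the relations `r e`, and the sets `U i` form
a cover of `D` by open sets saturated with respect to these relations. -/
structure IsGluing (q : C(D, X)) (r : E → D → D → Prop) (U : ι → Set D) : Prop where
  isQuotientMap : IsQuotientMap q
  eqvGen : ∀ z z', q z = q z' → Relation.EqvGen (fun z z' => ∃ e, r e z z') z z'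
  eq : ∀ e z z', r e z z' → q z = q z'
  isOpen : ∀ i, IsOpen (U i)
  cover : ∀ z, ∃ i, z ∈ U i
  mem_iff : ∀ i e z z', r e z z' → (z ∈ U i ↔ z' ∈ U i)

/-- A cochain on the cover `U` with values in the discrete group `G`, whose value is multiplied by
`x e` from the right when passing from a point to an `r e`-related one. It describes a covering
space of the quotient by the relations which becomes trivial over each `U i`. -/
structure IsGluingCochain {G : Type*} [Group G] [TopologicalSpace G] (r : E → D → D → Prop)
    (U : ι → Set D) (x : E → G) (s : ι → D → G) : Prop where
  continuousOn : ∀ i, ContinuousOn (s i) (U i)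
  eq_mul : ∀ i e z z', r e z z' → z ∈ U i → s i z' = s i z * x e

variable {q : C(D, X)} {r : E → D → D → Prop} {U : ι → Set D}

namespace IsGluing

theorem eq_of_eqvGen (h : IsGluing q r U) {z z' : D}
    (hz : Relation.EqvGen (fun z z' => ∃ e, r e z z') z z') : q z = q z' := by
  induction hz with
  | rel _ _ he => exact h.eq _ _ _ he.choose_spec
  | refl => rfl
  | symm _ _ _ ih => exact ih.symm
  | trans _ _ _ _ _ ih1 ih2 => exact ih1.trans ih2

theorem mem_iff_of_eq (h : IsGluing q r U) (i : ι) {z z' : D} (hz : q z = q z') :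
    z ∈ U i ↔ z' ∈ U i := by
  induction h.eqvGen z z' hz with
  | rel z z' he => exact h.mem_iff i _ z z' he.choose_spec
  | refl => rfl
  | symm z z' hzz' ih => exact (ih (h.eq_of_eqvGen hzz')).symm
  | trans z w z' hzw hwz' ih1 ih2 =>
    exact (ih1 (h.eq_of_eqvGen hzw)).trans (ih2 (h.eq_of_eqvGen hwz'))

theorem apply_eq_of_eq (h : IsGluing q r U) {α : Sort*} {f : D → α} {i j : ι}
    (hf : ∀ e z z', r e z z' → z ∈ U i → z ∈ U j → f z = f z') {z z' : D} (hz : q z = q z')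
    (hi : z ∈ U i) (hj : z ∈ U j) : f z = f z' := by
  induction h.eqvGen z z' hz with
  | rel z z' he => exact hf _ z z' he.choose_spec hi hj
  | refl => rfl
  | symm z z' hzz' ih =>
    have hq := h.eq_of_eqvGen hzz'
    exact (ih hq ((h.mem_iff_of_eq i hq).2 hi) ((h.mem_iff_of_eq j hq).2 hj)).symm
  | trans z w z' hzw hwz' ih1 ih2 =>
    have hq := h.eq_of_eqvGen hzw
    exact (ih1 hq hi hj).trans (ih2 (h.eq_of_eqvGen hwz') ((h.mem_iff_of_eq i hq).1 hi)
      ((h.mem_iff_of_eq j hq).1 hj))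

theorem preimage_image (h : IsGluing q r U) (i : ι) : q ⁻¹' (q '' U i) = U i :=
  Set.Subset.antisymm (fun _ ⟨_, hw, hz⟩ => (h.mem_iff_of_eq i hz).1 hw)
    (Set.subset_preimage_image q _)

theorem mem_image_iff (h : IsGluing q r U) (i : ι) {z : D} : q z ∈ q '' U i ↔ z ∈ U i :=
  Set.ext_iff.1 (h.preimage_image i) z

theorem isOpen_image (h : IsGluing q r U) (i : ι) : IsOpen (q '' U i) := by
  rw [← h.isQuotientMap.isOpen_preimage, h.preimage_image]
  exact h.isOpen i

end IsGluing

section ImageHom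

variable [SimplyConnectedSpace D]

/-- The class of the image of any path from `z` to `w` in the simply connected space `D`. -/
noncomputable def imageHom (q : C(D, X)) (z w : D) :
    FundamentalGroupoid.mk (q z) ⟶ FundamentalGroupoid.mk (q w) :=
  (FundamentalGroupoid.map q).map (X := .mk z) (Y := .mk w)
    (Path.Homotopic.Quotient.mk (PathConnectedSpace.somePath z w))

/-- The loop in the quotient which runs inside `D` from the base point to `z`, and back from a point
`z'` with the same image. -/
noncomputable def gluingLoop (q : C(D, X)) (z₀ : D) {z z' : D} (h : q z = q z') :
    FundamentalGroup X (q z₀) :=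
  imageHom q z₀ z ≫ eqToHom (congrArg FundamentalGroupoid.mk h) ≫ imageHom q z' z₀

theorem map_eq_imageHom {z w : D} (p : Path.Homotopic.Quotient z w) :
    (FundamentalGroupoid.map q).map (X := .mk z) (Y := .mk w) p = imageHom q z w :=
  congrArg ((FundamentalGroupoid.map q).map (X := .mk z) (Y := .mk w))
    (Subsingleton.elim (α := Path.Homotopic.Quotient z w) _ _)

theorem mk_map_eq_imageHom {z w : D} (P : Path z w) :
    (Path.Homotopic.Quotient.mk (P.map q.continuous) :
      FundamentalGroupoid.mk (q z) ⟶ FundamentalGroupoid.mk (q w)) = imageHom q z w :=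
  map_eq_imageHom (Path.Homotopic.Quotient.mk P)

@[simp]
theorem imageHom_self (z : D) : imageHom q z z = 𝟙 _ :=
  (map_eq_imageHom (Path.Homotopic.Quotient.refl z)).symm

@[simp]
theorem imageHom_comp (z w u : D) : imageHom q z w ≫ imageHom q w u = imageHom q z u := by
  rw [← map_eq_imageHom ((Path.Homotopic.Quotient.mk (PathConnectedSpace.somePath z w)).trans
    (Path.Homotopic.Quotient.mk (PathConnectedSpace.somePath w u)))]
  exact ((FundamentalGroupoid.map q).map_comp (X := .mk z) (Y := .mk w) (Z := .mk u) _ _).symm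

@[simp]
theorem imageHom_comp_assoc (z w u : D) {y : FundamentalGroupoid X}
    (f : FundamentalGroupoid.mk (q u) ⟶ y) :
    imageHom q z w ≫ imageHom q w u ≫ f = imageHom q z u ≫ f := by
  rw [← Category.assoc, imageHom_comp]

theorem gluingLoop_refl (z₀ z : D) : gluingLoop q z₀ (Eq.refl (q z)) = 1 := by
  simp only [gluingLoop, eqToHom_refl, Category.id_comp, imageHom_comp, imageHom_self]
  rfl

theorem gluingLoop_of_eq (z₀ : D) {z z' : D} (h : z = z') :
    gluingLoop q z₀ (congrArg q h) = 1 := by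
  subst h
  exact gluingLoop_refl z₀ z

theorem gluingLoop_trans (z₀ : D) {z w z' : D} (h : q z = q w) (h' : q w = q z') :
    gluingLoop q z₀ (h.trans h') = gluingLoop q z₀ h' * gluingLoop q z₀ h := by
  change _ = (_ ≫ _ ≫ _) ≫ (_ ≫ _ ≫ _)
  simp [gluingLoop]

theorem gluingLoop_symm (z₀ : D) {z z' : D} (h : q z = q z') :
    gluingLoop q z₀ h.symm = (gluingLoop q z₀ h)⁻¹ := by
  rw [eq_inv_iff_mul_eq_one, ← gluingLoop_trans, gluingLoop_refl]

theorem mk_comp_eqToHom {x y x' y' : X} (P : Path x y) (P' : Path x' y') (h : ∀ t, P t = P' t)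
    (hx : x = x') (hy : y = y') :
    (Path.Homotopic.Quotient.mk P : FundamentalGroupoid.mk x ⟶ FundamentalGroupoid.mk y) ≫
      eqToHom (congrArg FundamentalGroupoid.mk hy) =
    eqToHom (congrArg FundamentalGroupoid.mk hx) ≫
      (Path.Homotopic.Quotient.mk P' :
        FundamentalGroupoid.mk x' ⟶ FundamentalGroupoid.mk y') := by
  subst hx hy
  obtain rfl : P = P' := Path.ext (funext h)
  simp

theorem gluingLoop_eq_of_path (z₀ : D) {z w z' w' : D} (P : Path z w) (P' : Path z' w')
    (h : ∀ t, q (P t) = q (P' t)) (hz : q z = q z') (hw : q w = q w') :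
    gluingLoop q z₀ hz = gluingLoop q z₀ hw := by
  have himage := mk_comp_eqToHom (P.map q.continuous) (P'.map q.continuous) h hz hw
  rw [mk_map_eq_imageHom, mk_map_eq_imageHom] at himage
  rw [gluingLoop, gluingLoop, ← imageHom_comp z' w' z₀, ← imageHom_comp z₀ z w, Category.assoc,
    reassoc_of% himage]

theorem IsGluing.gluingLoop_mem (h : IsGluing q r U) {z₀ : D}
    {H : Subgroup (FundamentalGroup X (q z₀))}
    (hH : ∀ e z z', r e z z' → ∀ hz : q z = q z', gluingLoop q z₀ hz ∈ H) {z z' : D}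
    (hz : q z = q z') : gluingLoop q z₀ hz ∈ H := by
  induction h.eqvGen z z' hz with
  | rel z z' he => exact hH _ z z' he.choose_spec hz
  | refl z =>
    rw [gluingLoop_refl]
    exact H.one_mem
  | symm z z' _ ih =>
    rw [gluingLoop_symm z₀ hz.symm]
    exact H.inv_mem (ih hz.symm)
  | trans z w z' hzw _ ih1 ih2 =>
    have hzw := h.eq_of_eqvGen hzw
    rw [gluingLoop_trans z₀ hzw (hzw.symm.trans hz)]
    exact H.mul_mem (ih2 _) (ih1 _)

end ImageHom

namespace IsGluing

section Monodromy

/-- The transition function between the coordinates given by `s i` and `s j`. Its value at a point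
which does not lie in the images of both `U i` and `U j` is irrelevant. -/
noncomputable def transition (h : IsGluing q r U) {G : Type*} [Group G] (s : ι → D → G) (i j : ι)
    (y : X) : G :=
  s j (Function.surjInv h.isQuotientMap.surjective y) *
    (s i (Function.surjInv h.isQuotientMap.surjective y))⁻¹

variable (h : IsGluing q r U) {G : Type*} [Group G] [TopologicalSpace G] {x : E → G}
  {s : ι → D → G} (hs : IsGluingCochain r U x s)

include hs in
theorem transition_apply {i j : ι} {z : D} (hi : z ∈ U i) (hj : z ∈ U j) :
    h.transition s i j (q z) = s j z * (s i z)⁻¹ := by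
  refine (h.apply_eq_of_eq (f := fun z => s j z * (s i z)⁻¹) (fun e z z' he hi hj => ?_)
    (Function.surjInv_eq h.isQuotientMap.surjective (q z)).symm hi hj).symm
  simp [hs.eq_mul i e z z' he hi, hs.eq_mul j e z z' he hj]

include hs in
theorem continuousOn_transition [DiscreteTopology G] (i j : ι) :
    ContinuousOn (h.transition s i j) (q '' U i ∩ q '' U j) := by
  rw [h.isQuotientMap.continuousOn_isOpen_iff ((h.isOpen_image i).inter (h.isOpen_image j)),
    Set.preimage_inter, h.preimage_image, h.preimage_image]
  refine ContinuousOn.congr (f := fun z => s j z * (s i z)⁻¹) ?_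
    fun z hz => h.transition_apply hs hz.1 hz.2
  exact ((hs.continuousOn j).mono Set.inter_subset_right).mul
    ((hs.continuousOn i).mono Set.inter_subset_left).inv

variable [DiscreteTopology G]

/-- The covering space described by a cochain. -/
noncomputable def coveringCore : FiberBundleCore ι X G where
  baseSet i := q '' U i
  isOpen_baseSet := h.isOpen_image
  indexAt y := (h.cover (Function.surjInv h.isQuotientMap.surjective y)).choose
  mem_baseSet_at y := ⟨_, (h.cover (Function.surjInv h.isQuotientMap.surjective y)).choose_spec,
    Function.surjInv_eq h.isQuotientMap.surjective y⟩
  coordChange i j y k := h.transition s i j y * k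
  coordChange_self i := by
    rintro _ ⟨z, hz, rfl⟩ k
    simp [h.transition_apply hs hz hz]
  continuousOn_coordChange i j :=
    ((h.continuousOn_transition hs i j).comp continuousOn_fst fun _ hy => hy.1).mul
      continuousOn_snd
  coordChange_comp i j l := by
    rintro y ⟨⟨⟨z, hz, rfl⟩, hj⟩, hl⟩ k
    rw [h.mem_image_iff] at hj hl
    rw [h.transition_apply hs hz hj, h.transition_apply hs hz hl, h.transition_apply hs hj hl]
    group

/-- The lift of `q` to the covering space described by a cochain whose coordinate over `U i` is
`s i z * k`. -/
noncomputable def sheet (k : G) (z : D) : (h.coveringCore hs).TotalSpace :=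
  ⟨q z, s ((h.coveringCore hs).indexAt (q z)) z * k⟩

theorem mem_indexAt (z : D) : z ∈ U ((h.coveringCore hs).indexAt (q z)) :=
  (h.mem_image_iff _).1 ((h.coveringCore hs).mem_baseSet_at (q z))

theorem continuous_sheet (k : G) : Continuous (h.sheet hs k) := by
  refine continuous_iff_continuousAt.2 fun z₀ => ?_
  rw [FiberBundle.continuousAt_totalSpace]
  refine ⟨q.continuous.continuousAt, ?_⟩
  set i := (h.coveringCore hs).indexAt (q z₀)
  have hU : U i ∈ 𝓝 z₀ := (h.isOpen i).mem_nhds (h.mem_indexAt hs z₀)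
  refine ContinuousAt.congr (f := fun z => s i z * k)
    (((hs.continuousOn i).continuousAt hU).mul continuousAt_const) ?_
  filter_upwards [hU] with z hz
  change _ = h.transition s ((h.coveringCore hs).indexAt (q z)) i (q z) * (s _ z * k)
  rw [h.transition_apply hs (h.mem_indexAt hs z) hz]
  group

theorem sheet_eq_of_rel {e : E} {z z' : D} (hr : r e z z') (k : G) :
    h.sheet hs k z = h.sheet hs ((x e)⁻¹ * k) z' := by
  unfold sheet
  rw [← h.eq e z z' hr, hs.eq_mul _ e z z' hr (h.mem_indexAt hs z), mul_assoc,
    mul_inv_cancel_left]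

end Monodromy

theorem exists_monodromy [SimplyConnectedSpace D] (h : IsGluing q r U) {G : Type v} [Group G]
    [TopologicalSpace G] [DiscreteTopology G] {x : E → G} {s : ι → D → G}
    (hs : IsGluingCochain r U x s) (z₀ : D) :
    ∃ (Ω : Type (max u v)) (M : FundamentalGroup X (q z₀) →* Equiv.Perm Ω) (Λ : G → Ω),
      Function.Injective Λ ∧ ∀ e z z', r e z z' → ∀ (hz : q z = q z') (k : G),
        M (gluingLoop q z₀ hz) (Λ k) = Λ ((x e)⁻¹ * k) := by
  set Z := h.coveringCore hs
  have hcov : IsCoveringMap Z.proj := FiberBundle.isCoveringMap (F := G) (E := Z.Fiber)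
  let Λ (k : G) (z : D) : Z.proj ⁻¹' {q z} := ⟨h.sheet hs k z, rfl⟩
  have monodromy_imageHom (k : G) (z w : D) :
      hcov.monodromy (imageHom q z w) (Λ k z) = Λ k w :=
    let P : Path (h.sheet hs k z) (h.sheet hs k w) :=
      (PathConnectedSpace.somePath z w).map (h.continuous_sheet hs k)
    hcov.monodromy_eq_of_map_eq (ex := Λ k z) (ey := Λ k w) (Path.Homotopic.Quotient.mk P) rfl
  have monodromy_eqToHom {y y' : X} (hy : y = y') (ω : Z.proj ⁻¹' {y}) :
      (hcov.monodromy (eqToHom (congrArg FundamentalGroupoid.mk hy)) ω : Z.TotalSpace) = ω := by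
    subst hy
    exact congrArg Subtype.val (congrFun hcov.monodromy_refl ω)
  refine ⟨_, hcov.monodromyPerm (q z₀), fun k => Λ k z₀, fun k k' hk => ?_,
    fun e z z' hr hz k => ?_⟩
  · exact mul_left_cancel (congrArg (fun ω => ω.1.2) hk)
  · have cross : hcov.monodromy (eqToHom (congrArg FundamentalGroupoid.mk hz)) (Λ k z) =
        Λ ((x e)⁻¹ * k) z' :=
      Subtype.ext ((monodromy_eqToHom hz _).trans (h.sheet_eq_of_rel hs hr k))
    calc
      _ = hcov.monodromy (eqToHom (congrArg FundamentalGroupoid.mk hz) ≫ imageHom q z' z₀)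
          (hcov.monodromy (imageHom q z₀ z) (Λ k z₀)) :=
        hcov.monodromy_trans_apply _ _ _
      _ = hcov.monodromy (imageHom q z' z₀)
          (hcov.monodromy (eqToHom (congrArg FundamentalGroupoid.mk hz)) (Λ k z)) := by
        rw [monodromy_imageHom]
        exact hcov.monodromy_trans_apply _ _ _
      _ = Λ ((x e)⁻¹ * k) z₀ := by rw [cross, monodromy_imageHom]

end IsGluing

section Generation

variable [SimplyConnectedSpace D]

/-- The loop obtained from a homotopy class of paths by joining the base point to points over the
endpoints belongs to the subgroup `H`. -/
def ClosesUpIn {z₀ : D} (H : Subgroup (FundamentalGroup X (q z₀))) {x y : X} (P : Path x y) :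
    Prop :=
  ∀ (z w : D) (hz : q z = x) (hw : y = q w),
    (imageHom q z₀ z ≫ eqToHom (congrArg FundamentalGroupoid.mk hz) ≫
      (Path.Homotopic.Quotient.mk P : FundamentalGroupoid.mk x ⟶ FundamentalGroupoid.mk y) ≫
      eqToHom (congrArg FundamentalGroupoid.mk hw) ≫ imageHom q w z₀ :
        FundamentalGroup X (q z₀)) ∈ H

namespace ClosesUpIn

variable {z₀ : D} {H : Subgroup (FundamentalGroup X (q z₀))}

theorem congr {x y x' y' : X} {P : Path x y} {P' : Path x' y'} (hP : ClosesUpIn H P)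
    (h : ∀ t, P t = P' t) : ClosesUpIn H P' := by
  obtain rfl : x = x' := by simpa using h 0
  obtain rfl : y = y' := by simpa using h 1
  obtain rfl : P = P' := Path.ext (funext h)
  exact hP

theorem of_homotopic {x y : X} {P P' : Path x y} (hP : ClosesUpIn H P) (h : P.Homotopic P') :
    ClosesUpIn H P' := by
  intro z w hz hw
  rw [← Path.Homotopic.Quotient.eq.2 h]
  exact hP z w hz hw

theorem map (hH : ∀ (z z' : D) (hz : q z = q z'), gluingLoop q z₀ hz ∈ H) {z w : D}
    (P : Path z w) : ClosesUpIn H (P.map q.continuous) := by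
  intro z' w' hz hw
  rw [mk_map_eq_imageHom]
  refine (congrArg (· ∈ H) ?_).mp (H.mul_mem (hH _ _ hw) (hH _ _ hz))
  change (_ ≫ _ ≫ _) ≫ (_ ≫ _ ≫ _) = _
  simp

theorem const (hq : Function.Surjective q)
    (hH : ∀ (z z' : D) (hz : q z = q z'), gluingLoop q z₀ hz ∈ H) {x y : X} {P : Path x y}
    (hP : ∀ t, P t = P 0) : ClosesUpIn H P := by
  obtain ⟨z, hz⟩ := hq (P 0)
  exact (map hH (Path.refl z)).congr fun t => hz.trans (hP t).symm

theorem trans (hq : Function.Surjective q) {x y y' : X} {P : Path x y} {Q : Path y y'}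
    (hP : ClosesUpIn H P) (hQ : ClosesUpIn H Q) : ClosesUpIn H (P.trans Q) := by
  intro z w hz hw
  obtain ⟨u, rfl⟩ := hq y
  refine (congrArg (· ∈ H) ?_).mp (H.mul_mem (hQ u w rfl hw) (hP z u hz rfl))
  change (_ ≫ _ ≫ _ ≫ _ ≫ _) ≫ (_ ≫ _ ≫ _ ≫ _ ≫ _) = _
  rw [Path.Homotopic.Quotient.mk_trans]
  change _ = _ ≫ _ ≫ (_ ≫ _) ≫ _ ≫ _
  simp

theorem of_trans (hq : Function.Surjective q) {x y y' : X} {P : Path x y} {Q : Path y y'}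
    (hP : ClosesUpIn H (P.trans Q)) (hQ : ClosesUpIn H Q) : ClosesUpIn H P := by
  intro z w hz hw
  obtain ⟨u, rfl⟩ := hq y'
  refine (H.mul_mem_cancel_left (hQ w u hw.symm rfl)).1 ?_
  refine (congrArg (· ∈ H) ?_).mp (hP z u hz rfl)
  change _ = (_ ≫ _ ≫ _ ≫ _ ≫ _) ≫ (_ ≫ _ ≫ _ ≫ _ ≫ _)
  rw [Path.Homotopic.Quotient.mk_trans]
  change _ ≫ _ ≫ (_ ≫ _) ≫ _ ≫ _ = _
  simp

end ClosesUpIn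

end Generation

section Collapse

/-- A deformation of the open set `V ⊆ D`, compatible with the relations, whose end map is locally
constant. -/
structure IsCollapse (q : C(D, X)) (r : E → D → D → Prop) (V : Set D) (C : D × I → D) : Prop where
  continuousOn : ContinuousOn C (V ×ˢ Set.univ)
  zero : ∀ z ∈ V, C (z, 0) = z
  compat : ∀ e z z' t, r e z z' → z ∈ V → q (C (z, t)) = q (C (z', t))
  one : ∀ z ∈ V, ∀ᶠ w in 𝓝 z, C (w, 1) = C (z, 1)

namespace IsGluing

theorem exists_descended_collapse (h : IsGluing q r U) {i : ι} {C : D × I → D}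
    (hC : IsCollapse q r (U i) C) :
    ∃ F : C((q '' U i) × I, X), ∀ z (hz : z ∈ U i) t,
      F (⟨q z, Set.mem_image_of_mem q hz⟩, t) = q (C (z, t)) := by
  have hqs := h.isQuotientMap.surjective
  have hinv (z : D) (hz : z ∈ U i) (t : I) :
      q (C (Function.surjInv hqs (q z), t)) = q (C (z, t)) :=
    (h.apply_eq_of_eq (f := fun z => q (C (z, t))) (fun e z z' hr hz _ => hC.compat e z z' t hr hz)
      (Function.surjInv_eq hqs (q z)).symm hz hz).symm
  have hqV : IsQuotientMap ((q '' U i).restrictPreimage q) :=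
    h.isQuotientMap.restrictPreimage_isOpen (h.isOpen_image i)
  have hmem (z : q ⁻¹' (q '' U i)) : z.1 ∈ U i := (h.mem_image_iff i).1 z.2
  refine ⟨⟨fun p => q (C (Function.surjInv hqs p.1, p.2)), hqV.continuous_lift_prod_left ?_⟩, hinv⟩
  refine Continuous.congr (f := fun p : (q ⁻¹' (q '' U i)) × I => q (C (p.1.1, p.2))) ?_
    fun p => (hinv p.1.1 (hmem p.1) p.2).symm
  exact q.continuous.comp
    (hC.continuousOn.comp_continuous (by fun_prop) fun p => ⟨hmem p.1, trivial⟩)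

theorem isLocallyConstant_descended_collapse (h : IsGluing q r U) {i : ι} {C : D × I → D}
    (hC : IsCollapse q r (U i) C) {f : q '' U i → X}
    (hf : ∀ z (hz : z ∈ U i), f ⟨q z, Set.mem_image_of_mem q hz⟩ = q (C (z, 1))) :
    IsLocallyConstant f := by
  have hqV : IsQuotientMap ((q '' U i).restrictPreimage q) :=
    h.isQuotientMap.restrictPreimage_isOpen (h.isOpen_image i)
  have hmem (z : q ⁻¹' (q '' U i)) : z.1 ∈ U i := (h.mem_image_iff i).1 z.2
  refine IsLocallyConstant.iff_isOpen_fiber.2 fun y => ?_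
  rw [← hqV.isOpen_preimage, isOpen_iff_mem_nhds]
  intro z hz
  filter_upwards [continuousAt_subtype_val.eventually (hC.one z.1 (hmem z))] with w hw
  exact (hf w.1 (hmem w)).trans ((congrArg q hw).trans ((hf z.1 (hmem z)).symm.trans hz))

variable [SimplyConnectedSpace D]

/-- The descended collapse deforms the path to a constant one, and the tracks of its endpoints are
images of paths in `D`. -/
theorem closesUpIn_of_range_subset (h : IsGluing q r U) {z₀ : D}
    {H : Subgroup (FundamentalGroup X (q z₀))}
    (hH : ∀ (z z' : D) (hz : q z = q z'), gluingLoop q z₀ hz ∈ H) {i : ι} {C : D × I → D}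
    (hC : IsCollapse q r (U i) C) {x y : X} (P : Path x y) (hP : ∀ t, P t ∈ q '' U i) :
    ClosesUpIn H P := by
  have hqs := h.isQuotientMap.surjective
  obtain ⟨F, hF⟩ := h.exists_descended_collapse hC
  let f : C(q '' U i, X) := ⟨Subtype.val, continuous_subtype_val⟩
  let g : C(q '' U i, X) := F.comp ⟨fun v => (v, 1), by fun_prop⟩
  let Φ : f.Homotopy g :=
    { toContinuousMap := F.comp ⟨Prod.swap, continuous_swap⟩
      map_zero_left := by
        rintro ⟨_, z, hz, rfl⟩
        exact (hF z hz 0).trans (congrArg q (hC.zero z hz))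
      map_one_left := fun v => rfl }
  let P' : Path (⟨x, by simpa using hP 0⟩ : q '' U i) ⟨y, by simpa using hP 1⟩ :=
    { toFun := fun t => ⟨P t, hP t⟩
      source' := by simp
      target' := by simp }
  have closesUpIn_track (v : q '' U i) : ClosesUpIn H (Φ.evalAt v) := by
    obtain ⟨_, z, hz, rfl⟩ := v
    let Q : Path (C (z, 0)) (C (z, 1)) :=
      { toFun := fun t => C (z, t)
        continuous_toFun := hC.continuousOn.comp_continuous (by fun_prop) fun p => ⟨hz, trivial⟩
        source' := rfl
        target' := rfl }
    exact (ClosesUpIn.map hH Q).congr fun t => (hF z hz t).symm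
  have hg : IsLocallyConstant g :=
    h.isLocallyConstant_descended_collapse hC fun z hz => hF z hz 1
  have closesUpIn_end : ClosesUpIn H (P'.map (map_continuous g)) :=
    ClosesUpIn.const hqs hH fun t =>
      (hg.comp_continuous P'.continuous).apply_eq_of_isPreconnected isPreconnected_univ
        (Set.mem_univ _) (Set.mem_univ _)
  have closesUpIn_trans : ClosesUpIn H ((P'.map (map_continuous f)).trans (Φ.evalAt _)) :=
    ((closesUpIn_track _).trans hqs closesUpIn_end).of_homotopic
      (Path.Homotopic.map_trans_evalAt Φ P').symm
  exact (closesUpIn_trans.of_trans hqs (closesUpIn_track _)).congr fun t => rfl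

theorem closesUpIn (h : IsGluing q r U) {z₀ : D} {H : Subgroup (FundamentalGroup X (q z₀))}
    (hH : ∀ e z z', r e z z' → ∀ hz : q z = q z', gluingLoop q z₀ hz ∈ H)
    (hC : ∀ i, ∃ C : D × I → D, IsCollapse q r (U i) C) {x y : X} (P : Path x y) :
    ClosesUpIn H P := by
  have hqs := h.isQuotientMap.surjective
  have hH' (z z' : D) (hz : q z = q z') := h.gluingLoop_mem hH hz
  obtain ⟨t, ht0, htm, ⟨n, hn⟩, ht⟩ := exists_monotone_Icc_subset_open_cover_unitInterval
    (c := fun i => P ⁻¹' (q '' U i)) (fun i => (h.isOpen_image i).preimage P.continuous) (by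
      intro s _
      obtain ⟨z, hz⟩ := hqs (P s)
      obtain ⟨i, hi⟩ := h.cover z
      exact Set.mem_iUnion.2 ⟨i, z, hi, hz⟩)
  have closesUpIn_subpath (m : ℕ) : ClosesUpIn H (P.subpath (t 0) (t m)) := by
    induction m with
    | zero => exact ClosesUpIn.const hqs hH' fun s => by simp
    | succ m ih =>
      obtain ⟨i, hi⟩ := ht m
      obtain ⟨C, hC⟩ := hC i
      have range_subset (s : I) : P.subpath (t m) (t (m + 1)) s ∈ q '' U i := by
        have hs := Set.mem_range_self (f := P.subpath (t m) (t (m + 1))) s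
        rw [P.range_subpath_of_le _ _ (htm (Nat.le_succ m))] at hs
        obtain ⟨s', hs', hPs'⟩ := hs
        rw [← hPs']
        exact hi hs'
      exact (ih.trans hqs (h.closesUpIn_of_range_subset hH' hC _ range_subset)).of_homotopic
        ⟨Path.Homotopy.subpathTransSubpath P _ _ _⟩
  refine (closesUpIn_subpath n).congr fun s => ?_
  rw [ht0, hn n le_rfl, Path.subpath_zero_one]
  rfl

theorem eq_top_of_forall_gluingLoop_mem (h : IsGluing q r U) {z₀ : D}
    {H : Subgroup (FundamentalGroup X (q z₀))}
    (hH : ∀ e z z', r e z z' → ∀ hz : q z = q z', gluingLoop q z₀ hz ∈ H)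
    (hC : ∀ i, ∃ C : D × I → D, IsCollapse q r (U i) C) : H = ⊤ := by
  refine (Subgroup.eq_top_iff' H).2 fun γ => ?_
  obtain ⟨P, rfl⟩ := Path.Homotopic.Quotient.mk_surjective γ
  simpa using h.closesUpIn hH hC P z₀ z₀ rfl rfl

end IsGluing

end Collapse

end Gluing

local notation "𝔻" => Metric.closedBall (0 : ℂ) 1

section Sectors

open Topology unitInterval

instance : SimplyConnectedSpace 𝔻 :=
  have : ContractibleSpace 𝔻 := (convex_closedBall (0 : ℂ) 1).contractibleSpace ⟨0, by simp⟩
  SimplyConnectedSpace.ofContractible _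

variable {g : ℕ} {δ : ℝ} {z : 𝔻}

theorem boundaryPoint_eq_iff (hg : 0 < g) {x y : ℝ} :
    boundaryPoint g x = boundaryPoint g y ↔ ∃ m : ℤ, x = y + 4 * g * m := by
  have hg' : (g : ℝ) ≠ 0 := by positivity
  rw [Subtype.ext_iff]
  change Complex.exp _ = Complex.exp _ ↔ _
  rw [Complex.exp_eq_exp_iff_exists_int]
  refine exists_congr fun m => ?_
  rw [show (m : ℂ) * (2 * Real.pi * Complex.I) = ((m * (2 * Real.pi) : ℝ) : ℂ) * Complex.I by
    push_cast; ring, ← add_mul, mul_left_inj' Complex.I_ne_zero, ← Complex.ofReal_add,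
    Complex.ofReal_inj]
  field_simp

theorem boundaryPoint_add_mul_int (hg : 0 < g) (x : ℝ) (m : ℤ) :
    boundaryPoint g (x + 4 * g * m) = boundaryPoint g x :=
  (boundaryPoint_eq_iff hg).2 ⟨m, rfl⟩

theorem norm_boundaryPoint (g : ℕ) (x : ℝ) : ‖(boundaryPoint g x : ℂ)‖ = 1 :=
  Complex.norm_exp_ofReal_mul_I _

theorem boundaryPoint_ne_zero (x : ℝ) : (boundaryPoint g x : ℂ) ≠ 0 :=
  norm_ne_zero_iff.1 (by simp [norm_boundaryPoint])

theorem continuous_boundaryPoint (g : ℕ) : Continuous (boundaryPoint g) := by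
  unfold boundaryPoint
  fun_prop

theorem boundaryPoint_add_val (g : ℕ) (x y : ℝ) :
    (boundaryPoint g (x + y) : ℂ) = boundaryPoint g x * boundaryPoint g y := by
  change Complex.exp _ = Complex.exp _ * Complex.exp _
  rw [← Complex.exp_add]
  congr 1
  push_cast
  ring

theorem boundaryPoint_neg_mul_val (g : ℕ) (x : ℝ) :
    (boundaryPoint g (-x) : ℂ) * boundaryPoint g x = 1 := by
  rw [← boundaryPoint_add_val]
  simp [boundaryPoint]

theorem boundaryPoint_two_mul_div_pi_mul_val (hg : 0 < g) (θ : ℝ) :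
    (boundaryPoint g (2 * g / Real.pi * θ) : ℂ) = Complex.exp (θ * Complex.I) := by
  have hg' : (g : ℝ) ≠ 0 := by positivity
  change Complex.exp _ = _
  congr 3
  field_simp
  ring

/-- The angular coordinate on the disc, in units in which the full circle has length `4 * g` as for
`boundaryPoint`. Its values lie in `(δ - 1 / 2, 4 * g + δ - 1 / 2]`, so that the branch cut is a
boundary ray of the sectors around the positions in `δ + ℤ`. -/
noncomputable def angularPosition (g : ℕ) (δ : ℝ) (z : 𝔻) : ℝ :=
  2 * g + δ - 1 / 2 + 2 * g / Real.pi * ((z : ℂ) * boundaryPoint g (-(2 * g + δ - 1 / 2))).arg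

/-- The distance to the centre of the disc. -/
noncomputable def radius (z : 𝔻) : I :=
  ⟨‖(z : ℂ)‖, norm_nonneg _, mem_closedBall_zero_iff.1 z.2⟩

/-- The point of the disc with polar coordinates `ρ` and `s`, where `s` is measured as for
`boundaryPoint`. -/
noncomputable def polarPoint (g : ℕ) (ρ : I) (s : ℝ) : 𝔻 :=
  ⟨((ρ : ℝ) : ℂ) * boundaryPoint g s, by
    rw [mem_closedBall_zero_iff, norm_mul, norm_boundaryPoint, mul_one, Complex.norm_real,
      Real.norm_of_nonneg ρ.2.1]
    exact ρ.2.2⟩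

theorem polarPoint_one (s : ℝ) : polarPoint g 1 s = boundaryPoint g s :=
  Subtype.ext (by simp [polarPoint])

theorem radius_boundaryPoint (s : ℝ) : radius (boundaryPoint g s) = 1 :=
  Subtype.ext (norm_boundaryPoint g s)

theorem continuous_radius : Continuous radius := by
  unfold radius
  fun_prop

theorem continuous_polarPoint : Continuous fun p : I × ℝ => polarPoint g p.1 p.2 := by
  have := continuous_boundaryPoint g
  unfold polarPoint
  fun_prop

theorem polarPoint_radius_angularPosition (hg : 0 < g) (δ : ℝ) (z : 𝔻) :
    polarPoint g (radius z) (angularPosition g δ z) = z := by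
  apply Subtype.ext
  change (‖(z : ℂ)‖ : ℂ) * _ = _
  set c : ℝ := 2 * g + δ - 1 / 2
  set w : ℂ := z * boundaryPoint g (-c) with hw
  have norm_w : ‖(z : ℂ)‖ = ‖w‖ := by rw [hw, norm_mul, norm_boundaryPoint, mul_one]
  calc (‖(z : ℂ)‖ : ℂ) * (boundaryPoint g (c + 2 * g / Real.pi * w.arg) : ℂ)
      = ‖w‖ * Complex.exp (w.arg * Complex.I) * boundaryPoint g c := by
        rw [boundaryPoint_add_val, boundaryPoint_two_mul_div_pi_mul_val hg, norm_w]
        ring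
    _ = z := by rw [Complex.norm_mul_exp_arg_mul_I, hw, mul_assoc, boundaryPoint_neg_mul_val,
        mul_one]

theorem exists_boundaryPoint_eq (hg : 0 < g) (hz : 1 ≤ ‖(z : ℂ)‖) : ∃ s, boundaryPoint g s = z := by
  have hradius : radius z = 1 := Subtype.ext (le_antisymm (radius z).2.2 hz)
  exact ⟨angularPosition g 0 z, by
    rw [← polarPoint_one, ← hradius, polarPoint_radius_angularPosition hg]⟩

theorem exists_angularPosition_boundaryPoint (hg : 0 < g) (δ s : ℝ) :
    ∃ m : ℤ, angularPosition g δ (boundaryPoint g s) = s + 4 * g * m := by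
  rw [← boundaryPoint_eq_iff hg, ← polarPoint_one, ← radius_boundaryPoint (g := g) s,
    polarPoint_radius_angularPosition hg]

/-- The union of the open sectors of angular width one around the positions in `δ + ℤ`. -/
def sectors (g : ℕ) (δ : ℝ) : Set 𝔻 :=
  {z | (z : ℂ) ≠ 0 ∧ ∀ n : ℤ, angularPosition g δ z ≠ n + δ + 1 / 2}

/-- The integer `n` for which a point of `sectors g δ` lies in the sector around `n + δ`. -/
noncomputable def sectorIndex (g : ℕ) (δ : ℝ) (z : 𝔻) : ℤ :=
  ⌊angularPosition g δ z - δ + 1 / 2⌋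

theorem continuousAt_angularPosition (hz : z ∈ sectors g δ) :
    ContinuousAt (angularPosition g δ) z := by
  unfold angularPosition
  refine continuousAt_const.add (continuousAt_const.mul
    (ContinuousAt.comp (g := Complex.arg) (Complex.continuousAt_arg ?_) (by fun_prop)))
  rw [Complex.mem_slitPlane_iff_arg]
  refine ⟨fun harg => hz.2 (4 * g - 1) ?_, mul_ne_zero hz.1 (boundaryPoint_ne_zero _)⟩
  rw [angularPosition, harg]
  push_cast
  field_simp
  ring

theorem abs_sub_sectorIndex_lt (hz : z ∈ sectors g δ) :
    |angularPosition g δ z - (sectorIndex g δ z + δ)| < 1 / 2 := by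
  have hle : (sectorIndex g δ z : ℝ) ≤ _ := Int.floor_le (angularPosition g δ z - δ + 1 / 2)
  have hlt : _ < (sectorIndex g δ z : ℝ) + 1 :=
    Int.lt_floor_add_one (angularPosition g δ z - δ + 1 / 2)
  have hne := hz.2 (sectorIndex g δ z - 1)
  push_cast at hne
  exact abs_lt.2 ⟨lt_of_le_of_ne (by linarith) fun h => hne (by linarith), by linarith⟩

theorem mem_sectors_and_sectorIndex_eq (hz₀ : (z : ℂ) ≠ 0) {n : ℤ}
    (hz : |angularPosition g δ z - (n + δ)| < 1 / 2) :
    z ∈ sectors g δ ∧ sectorIndex g δ z = n := by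
  rw [abs_lt] at hz
  refine ⟨⟨hz₀, fun m hm => ?_⟩, ?_⟩
  · have hmn : (m : ℝ) < n := by linarith
    have hnm : (n : ℝ) < m + 1 := by linarith
    norm_cast at hmn hnm
    omega
  · rw [sectorIndex, Int.floor_eq_iff]
    constructor <;> linarith

theorem eventually_sectorIndex_eq (hz : z ∈ sectors g δ) :
    ∀ᶠ w in 𝓝 z, w ∈ sectors g δ ∧ sectorIndex g δ w = sectorIndex g δ z := by
  have hdist : ContinuousAt (fun w => |angularPosition g δ w - (sectorIndex g δ z + δ)|) z :=
    ((continuousAt_angularPosition hz).sub continuousAt_const).abs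
  filter_upwards [hdist.eventually (gt_mem_nhds (abs_sub_sectorIndex_lt hz)),
    continuousAt_subtype_val.eventually (isOpen_ne.mem_nhds hz.1)] with w hw hw₀
  exact mem_sectors_and_sectorIndex_eq hw₀ hw

theorem isOpen_sectors (g : ℕ) (δ : ℝ) : IsOpen (sectors g δ) :=
  isOpen_iff_mem_nhds.2 fun _ hz => (eventually_sectorIndex_eq hz).mono fun _ h => h.1

theorem boundaryPoint_mem_sectors_iff (hg : 0 < g) {s : ℝ} :
    boundaryPoint g s ∈ sectors g δ ↔ ∀ n : ℤ, s ≠ n + δ + 1 / 2 := by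
  obtain ⟨m, hm⟩ := exists_angularPosition_boundaryPoint hg δ s
  refine ⟨fun h n hn => h.2 (n + 4 * g * m) ?_, fun h => ⟨boundaryPoint_ne_zero s,
    fun n hn => h (n - 4 * g * m) ?_⟩⟩
  · rw [hm, hn]
    push_cast
    ring
  · rw [hm] at hn
    push_cast
    linarith

theorem exists_sectorIndex_boundaryPoint (hg : 0 < g) {s : ℝ} {n : ℤ}
    (hs : |s - (n + δ)| < 1 / 2) :
    ∃ m : ℤ, angularPosition g δ (boundaryPoint g s) = s + 4 * g * m ∧
      sectorIndex g δ (boundaryPoint g s) = n + 4 * g * m := by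
  obtain ⟨m, hm⟩ := exists_angularPosition_boundaryPoint hg δ s
  refine ⟨m, hm, (mem_sectors_and_sectorIndex_eq (boundaryPoint_ne_zero s) ?_).2⟩
  rw [hm]
  push_cast
  convert hs using 2
  ring

/-- The deformation of `sectors g δ` which moves each sector around `n + δ` linearly in polar
coordinates onto the boundary point at the position `n + δ`. -/
noncomputable def sectorCollapse (g : ℕ) (δ : ℝ) (p : 𝔻 × I) : 𝔻 :=
  polarPoint g (σ (σ p.2 * σ (radius p.1)))
    (sectorIndex g δ p.1 + δ + σ p.2 * (angularPosition g δ p.1 - (sectorIndex g δ p.1 + δ)))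

theorem sectorCollapse_zero (hg : 0 < g) (δ : ℝ) (z : 𝔻) : sectorCollapse g δ (z, 0) = z := by
  simpa [sectorCollapse] using polarPoint_radius_angularPosition hg δ z

theorem sectorCollapse_one (g : ℕ) (δ : ℝ) (z : 𝔻) :
    sectorCollapse g δ (z, 1) = boundaryPoint g (sectorIndex g δ z + δ) := by
  simp [sectorCollapse, polarPoint_one]

theorem sectorCollapse_boundaryPoint (hg : 0 < g) {s : ℝ} {n : ℤ} (hs : |s - (n + δ)| < 1 / 2)
    (τ : I) : sectorCollapse g δ (boundaryPoint g s, τ) =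
      boundaryPoint g (n + δ + σ τ * (s - (n + δ))) := by
  obtain ⟨m, hm, hn⟩ := exists_sectorIndex_boundaryPoint hg hs
  rw [sectorCollapse]
  simp only [radius_boundaryPoint, hm, hn, symm_one, mul_zero, symm_zero, polarPoint_one]
  refine .trans ?_ (boundaryPoint_add_mul_int hg _ m)
  congr 1
  push_cast
  ring

theorem continuousOn_sectorCollapse (g : ℕ) (δ : ℝ) :
    ContinuousOn (sectorCollapse g δ) (sectors g δ ×ˢ Set.univ) := by
  rintro ⟨z, τ⟩ ⟨hz, -⟩
  apply ContinuousAt.continuousWithinAt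
  have hangle : ContinuousAt (fun p : 𝔻 × I => angularPosition g δ p.1) (z, τ) :=
    (continuousAt_angularPosition hz).comp (x := (z, τ)) continuousAt_fst
  have := continuous_radius
  refine ContinuousAt.congr (f := fun p => polarPoint g (σ (σ p.2 * σ (radius p.1)))
    (sectorIndex g δ z + δ + σ p.2 * (angularPosition g δ p.1 - (sectorIndex g δ z + δ)))) ?_ ?_
  · exact continuous_polarPoint.continuousAt.comp (f := fun p => (_, _))
      (ContinuousAt.prodMk (by fun_prop) (by fun_prop))
  · filter_upwards [(continuousAt_fst (p := (z, τ))).eventually (eventually_sectorIndex_eq hz)]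
      with p hp
    rw [sectorCollapse, hp.2]

end Sectors

section SurfaceCharts

open Topology unitInterval

variable {g : ℕ}

/-- The position at which the arc `a_(j + 1)`, for the label `(j, false)`, or `b_(j + 1)`, for the
label `(j, true)`, of the boundary word starts. -/
def arcStart (e : Fin g × Bool) : ℕ := 4 * e.1 + e.2.toNat

theorem arcStart_add_three_le (e : Fin g × Bool) : arcStart e + 3 ≤ 4 * g := by
  have := e.2.toNat_le
  rw [arcStart]
  omega

/-- The gluing of the arc with label `e` to the one with the inverse label, as a relation. -/
def arcGluing (g : ℕ) (e : Fin g × Bool) (z z' : 𝔻) : Prop :=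
  ∃ t : I, z = boundaryPoint g (arcStart e + t) ∧ z' = boundaryPoint g (arcStart e + 3 - t)

theorem exists_arcGluing_iff {z z' : 𝔻} : (∃ e, arcGluing g e z z') ↔ SideGluing g z z' := by
  constructor
  · rintro ⟨⟨j, _ | _⟩, t, rfl, rfl⟩
    · simpa [arcStart] using SideGluing.a j t
    · convert SideGluing.b j t using 2 <;> simp [arcStart]
      ring
  · rintro (⟨j, t⟩ | ⟨j, t⟩)
    · exact ⟨(j, false), t, by simp [arcStart], by simp [arcStart]⟩
    · refine ⟨(j, true), t, by simp [arcStart], congrArg _ ?_⟩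
      simp [arcStart]
      ring

/-- The quotient map from the disc to the surface. -/
def surfaceMk (g : ℕ) : C(𝔻, StandardSurface g) :=
  ⟨Quot.mk (SideGluing g), continuous_quot_mk⟩

/-- The offset of the centres of the sectors from the integers: with `false` the sectors are centred
at the vertices of the polygon, with `true` at the midpoints of its sides. -/
noncomputable def sectorOffset (c : Bool) : ℝ := bif c then 1 / 2 else 0

/-- The preimages of an atlas of the surface, consisting of the open disc and of neighbourhoods of
the vertex and of the open edges. -/
def surfaceCharts (g : ℕ) : Option Bool → Set 𝔻
  | none => {z | ‖(z : ℂ)‖ < 1}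
  | some c => sectors g (sectorOffset c)

theorem two_mul_sectorOffset (c : Bool) : 2 * sectorOffset c = (c.toNat : ℤ) := by
  cases c <;> simp [sectorOffset]

theorem exists_mem_surfaceCharts (hg : 0 < g) (z : 𝔻) : ∃ i, z ∈ surfaceCharts g i := by
  rcases lt_or_ge ‖(z : ℂ)‖ 1 with hz | hz
  · exact ⟨none, hz⟩
  obtain ⟨s, rfl⟩ := exists_boundaryPoint_eq hg hz
  by_contra! hnotMem
  have hvertex := hnotMem (some false)
  have hedge := hnotMem (some true)
  simp only [surfaceCharts, boundaryPoint_mem_sectors_iff hg, not_forall, not_not] at hvertex hedge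
  obtain ⟨m, hm⟩ := hvertex
  obtain ⟨n, hn⟩ := hedge
  have hparity : ((2 * m + 1 : ℤ) : ℝ) = (2 * n + 2 : ℤ) := by
    simp only [sectorOffset, cond_true, cond_false] at hm hn
    push_cast
    linarith
  have := Int.cast_injective hparity
  omega

theorem isGluing_surfaceMk (hg : 0 < g) :
    IsGluing (surfaceMk g) (arcGluing g) (surfaceCharts g) where
  isQuotientMap := isQuotientMap_quot_mk
  eqvGen _ _ h := (Quot.eqvGen_exact h).mono fun _ _ => exists_arcGluing_iff.2
  eq e _ _ h := Quot.sound (exists_arcGluing_iff.1 ⟨e, h⟩)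
  isOpen := by
    rintro (_ | c)
    · exact isOpen_lt (by fun_prop) (by fun_prop)
    · exact isOpen_sectors g _
  cover := exists_mem_surfaceCharts hg
  mem_iff := by
    rintro (_ | c) e _ _ ⟨t, rfl, rfl⟩
    · simp [surfaceCharts, norm_boundaryPoint]
    · -- The reflection exchanging the two arcs permutes the rays which bound the sectors.
      have hc := two_mul_sectorOffset c
      simp only [surfaceCharts, boundaryPoint_mem_sectors_iff hg]
      constructor <;> intro h n hn <;> refine h (2 * arcStart e + 2 - n - c.toNat) ?_ <;>
        push_cast at hc ⊢ <;> linarith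

/-- The sectors of offset `sectorOffset c` with indices `n` and `n'` are exchanged by the gluing of
the arc from `s` to `s + 1`, and the first of them meets this arc. -/
inductive FacingSectors (s : ℕ) : Bool → ℕ → ℕ → Prop
  | start : FacingSectors s false s (s + 3)
  | finish : FacingSectors s false (s + 1) (s + 2)
  | middle : FacingSectors s true s (s + 2)

namespace FacingSectors

variable {s n n' : ℕ} {c : Bool}

theorem mem_Icc (h : FacingSectors s c n n') : n + sectorOffset c ∈ Set.Icc (s : ℝ) (s + 1) := by
  cases h <;> constructor <;> norm_num [sectorOffset]

theorem add_eq (h : FacingSectors s c n n') :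
    (n + sectorOffset c) + (n' + sectorOffset c) = 2 * s + 3 := by
  cases h <;> simp only [sectorOffset, cond_true, cond_false, Nat.cast_add, Nat.cast_ofNat,
    Nat.cast_one] <;> ring

theorem left_le (h : FacingSectors s c n n') : n ≤ s + 3 := by
  cases h <;> omega

theorem right_le (h : FacingSectors s c n n') : n' ≤ s + 3 := by
  cases h <;> omega

theorem abs_sub_lt_of_abs_sub_lt (h : FacingSectors s c n n') {t : ℝ}
    (ht : |(s + t : ℝ) - (n + sectorOffset c)| < 1 / 2) :
    |(s + 3 - t : ℝ) - (n' + sectorOffset c)| < 1 / 2 := by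
  rw [abs_sub_comm]
  convert ht using 2
  linear_combination h.add_eq

end FacingSectors

theorem exists_facingSectors (hg : 0 < g) {c : Bool} {s : ℕ} {t : I}
    (h : boundaryPoint g (s + t) ∈ sectors g (sectorOffset c)) :
    ∃ n n', FacingSectors s c n n' ∧ |(s + t : ℝ) - (n + sectorOffset c)| < 1 / 2 := by
  obtain ⟨ht₀, ht₁⟩ := t.2
  rw [boundaryPoint_mem_sectors_iff hg] at h
  cases c
  · have hmiddle := h s
    simp only [sectorOffset, cond_false, add_zero, Int.cast_natCast, ne_eq, add_right_inj]
      at hmiddle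
    rcases lt_or_gt_of_ne hmiddle with ht | ht
    · exact ⟨s, s + 3, .start, by
        simp only [sectorOffset, cond_false, abs_lt]; constructor <;> linarith⟩
    · exact ⟨s + 1, s + 2, .finish, by
        simp only [sectorOffset, cond_false, abs_lt]; push_cast; constructor <;> linarith⟩
  · have hstart := h (s - 1)
    have hfinish := h s
    simp only [sectorOffset, cond_true] at hstart hfinish
    push_cast at hstart hfinish
    have ht₀' : (0 : ℝ) < t := lt_of_le_of_ne ht₀ fun ht => hstart (by linarith)
    have ht₁' : (t : ℝ) < 1 := lt_of_le_of_ne ht₁ fun ht => hfinish (by linarith)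
    exact ⟨s, s + 2, .middle, by
      simp only [sectorOffset, cond_true, abs_lt]; constructor <;> linarith⟩

theorem surfaceMk_sectorCollapse_eq (hg : 0 < g) {c : Bool} {e : Fin g × Bool} {t : I} {n n' : ℕ}
    (h : FacingSectors (arcStart e) c n n')
    (ht : |(arcStart e + t : ℝ) - (n + sectorOffset c)| < 1 / 2) (τ : I) :
    surfaceMk g (sectorCollapse g (sectorOffset c) (boundaryPoint g (arcStart e + t), τ)) =
      surfaceMk g
        (sectorCollapse g (sectorOffset c) (boundaryPoint g (arcStart e + 3 - t), τ)) := by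
  rw [sectorCollapse_boundaryPoint (n := n) hg (by simpa using ht),
    sectorCollapse_boundaryPoint (n := n') hg (by simpa using h.abs_sub_lt_of_abs_sub_lt ht)]
  have hcentre : n + sectorOffset c - arcStart e ∈ I := by
    obtain ⟨hle, hge⟩ := h.mem_Icc
    constructor <;> linarith
  have hmem := (convex_Icc (0 : ℝ) 1).add_smul_sub_mem hcentre t.2 (σ τ).2
  refine (isGluing_surfaceMk hg).eq e _ _ ⟨⟨_, hmem⟩, ?_, ?_⟩ <;> congr 1 <;>
    simp only [smul_eq_mul, Int.cast_natCast]
  · ring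
  · linear_combination (1 - (σ τ : ℝ)) * h.add_eq

theorem isCollapse_sectorCollapse (hg : 0 < g) (c : Bool) :
    IsCollapse (surfaceMk g) (arcGluing g) (sectors g (sectorOffset c))
      (sectorCollapse g (sectorOffset c)) where
  continuousOn := continuousOn_sectorCollapse g _
  zero z _ := sectorCollapse_zero hg _ z
  compat := by
    rintro e _ _ τ ⟨t, rfl, rfl⟩ hz
    obtain ⟨n, n', hfacing, ht⟩ := exists_facingSectors hg hz
    exact surfaceMk_sectorCollapse_eq hg hfacing ht τ
  one z hz := by
    filter_upwards [eventually_sectorIndex_eq hz] with w hw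
    rw [sectorCollapse_one, sectorCollapse_one, hw.2]

theorem boundaryPoint_notMem_surfaceCharts_none (s : ℝ) :
    boundaryPoint g s ∉ surfaceCharts g none := by
  simp [surfaceCharts, norm_boundaryPoint]

theorem exists_isCollapse (hg : 0 < g) (i : Option Bool) :
    ∃ C, IsCollapse (surfaceMk g) (arcGluing g) (surfaceCharts g i) C := by
  rcases i with _ | c
  · refine ⟨fun p => ⟨((σ p.2 : ℝ) : ℂ) * p.1, ?_⟩, ?_, by simp, ?_, by simp⟩
    · rw [mem_closedBall_zero_iff, norm_mul, Complex.norm_real, Real.norm_of_nonneg (σ p.2).2.1]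
      exact mul_le_one₀ (σ p.2).2.2 (norm_nonneg _) (mem_closedBall_zero_iff.1 p.1.2)
    · fun_prop
    · rintro e _ _ τ ⟨t, rfl, rfl⟩ hz
      exact absurd hz (boundaryPoint_notMem_surfaceCharts_none _)
  · exact ⟨_, isCollapse_sectorCollapse hg c⟩

end SurfaceCharts

section SurfaceCochain

open Topology unitInterval

variable {Γ : Type*} [Group Γ] {g : ℕ}

/-- The values of a cochain on the sectors: `sectorValue a b false n` is the value around the vertex
at the position `n`, and `sectorValue a b true n` the value around the midpoint of the side from `n`
to `n + 1`. -/
def sectorValue (a b : ℕ → Γ) : Bool → ℕ → Γ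
  | false, n => commutatorProd a b (n / 4) * match n % 4 with
    | 0 => 1
    | 1 => a (n / 4) * b (n / 4) * (a (n / 4))⁻¹
    | 2 => a (n / 4) * b (n / 4)
    | _ => a (n / 4)
  | true, n => match n % 4 with
    | 0 => 1
    | 1 => 1
    | 2 => a (n / 4)
    | _ => (b (n / 4))⁻¹

/-- The group element by which the cochain with values `sectorValue a b` changes under the gluing of
the arc with label `e`. -/
def arcValue (a b : ℕ → Γ) (e : Fin g × Bool) : Γ :=
  bif e.2 then (b e.1)⁻¹ else a e.1

theorem sectorValue_eq_mul_arcValue (a b : ℕ → Γ) {e : Fin g × Bool} {c : Bool} {n n' : ℕ}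
    (h : FacingSectors (arcStart e) c n n') :
    sectorValue a b c n' = sectorValue a b c n * arcValue a b e := by
  obtain ⟨j, _ | _⟩ := e <;> cases h <;>
    simp [sectorValue, arcStart, arcValue, Nat.mul_add_div, add_assoc, mul_assoc,
      commutatorProd_succ, commutatorElement_def]

theorem sectorValue_mod {a b : ℕ → Γ} (hab : commutatorProd a b g = 1) (c : Bool) {n : ℕ}
    (hn : n ≤ 4 * g) : sectorValue a b c (n % (4 * g)) = sectorValue a b c n := by
  rcases hn.lt_or_eq with h | rfl
  · rw [Nat.mod_eq_of_lt h]
  · cases c <;> simp [sectorValue, hab]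

/-- A cochain in the charts of the surface, which describes the covering space of the surface whose
monodromy is given by the elements `a j` and `b j` of `Γ`. -/
noncomputable def surfaceCochain (g : ℕ) (a b : ℕ → Γ) : Option Bool → 𝔻 → Γ
  | none, _ => 1
  | some c, z => sectorValue a b c (sectorIndex g (sectorOffset c) z % (4 * g : ℕ)).toNat

theorem toNat_sectorIndex_boundaryPoint (hg : 0 < g) {δ s : ℝ} {n : ℕ}
    (hs : |s - (n + δ)| < 1 / 2) :
    (sectorIndex g δ (boundaryPoint g s) % (4 * g : ℕ)).toNat = n % (4 * g) := by
  obtain ⟨m, -, hm⟩ := exists_sectorIndex_boundaryPoint (n := n) hg (by simpa using hs)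
  rw [hm, show (4 : ℤ) * g = (4 * g : ℕ) by push_cast; rfl, Int.add_mul_emod_self_left]
  norm_cast

theorem surfaceCochain_boundaryPoint (hg : 0 < g) {a b : ℕ → Γ} (hab : commutatorProd a b g = 1)
    {c : Bool} {s : ℝ} {n : ℕ} (hn : n ≤ 4 * g) (hs : |s - (n + sectorOffset c)| < 1 / 2) :
    surfaceCochain g a b (some c) (boundaryPoint g s) = sectorValue a b c n := by
  rw [surfaceCochain, toNat_sectorIndex_boundaryPoint hg hs, sectorValue_mod hab c hn]

theorem isGluingCochain_surfaceCochain [TopologicalSpace Γ] (hg : 0 < g) {a b : ℕ → Γ}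
    (hab : commutatorProd a b g = 1) :
    IsGluingCochain (arcGluing g) (surfaceCharts g) (arcValue a b) (surfaceCochain g a b) where
  continuousOn := by
    rintro (_ | c) z hz
    · exact continuousWithinAt_const
    · refine (ContinuousAt.congr (f := fun _ => surfaceCochain g a b (some c) z) continuousAt_const
        ((eventually_sectorIndex_eq hz).mono fun w hw => ?_)).continuousWithinAt
      exact congrArg (fun k : ℤ => sectorValue a b c (k % (4 * g : ℕ)).toNat) hw.2.symm
  eq_mul := by
    rintro (_ | c) e _ _ ⟨t, rfl, rfl⟩ hz
    · exact absurd hz (boundaryPoint_notMem_surfaceCharts_none _)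
    obtain ⟨n, n', hfacing, ht⟩ := exists_facingSectors hg hz
    have he := arcStart_add_three_le e
    rw [surfaceCochain_boundaryPoint hg hab (hfacing.left_le.trans he) ht,
      surfaceCochain_boundaryPoint hg hab (hfacing.right_le.trans he)
        (hfacing.abs_sub_lt_of_abs_sub_lt ht),
      sectorValue_eq_mul_arcValue a b hfacing]

end SurfaceCochain

section SurfaceFundamentalGroup

open unitInterval

variable {g : ℕ}

theorem arcGluing_arcStart (e : Fin g × Bool) :
    arcGluing g e (boundaryPoint g (arcStart e : ℕ)) (boundaryPoint g (arcStart e + 3 : ℕ)) :=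
  ⟨0, by simp, by simp⟩

theorem arcGluing_arcStart_add_one (e : Fin g × Bool) :
    arcGluing g e (boundaryPoint g (arcStart e + 1 : ℕ))
      (boundaryPoint g (arcStart e + 2 : ℕ)) :=
  ⟨1, by simp, by push_cast [Set.Icc.coe_one]; congr 1; ring⟩

theorem surfaceMk_vertex_succ (hg : 0 < g) (k : ℕ) :
    surfaceMk g (boundaryPoint g (k + 1 : ℕ)) = surfaceMk g (boundaryPoint g k) := by
  have periodic (n m : ℕ) : boundaryPoint g (n + 4 * g * m : ℕ) = boundaryPoint g n :=
    (boundaryPoint_eq_iff hg).2 ⟨m, by push_cast; rfl⟩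
  obtain ⟨n, m, hn, rfl⟩ : ∃ n m, n < 4 * g ∧ k = n + 4 * g * m :=
    ⟨k % (4 * g), k / (4 * g), Nat.mod_lt _ (by omega), (Nat.mod_add_div _ _).symm⟩
  rw [add_right_comm, periodic, periodic]
  obtain ⟨j, i, hi, rfl⟩ : ∃ (j : Fin g) (i : ℕ), i < 4 ∧ n = 4 * j + i :=
    ⟨⟨n / 4, by omega⟩, n % 4, Nat.mod_lt _ (by omega), (Nat.div_add_mod _ _).symm⟩
  have ha := (isGluing_surfaceMk hg).eq _ _ _ (arcGluing_arcStart (j, false))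
  have ha' := (isGluing_surfaceMk hg).eq _ _ _ (arcGluing_arcStart_add_one (j, false))
  have hb := (isGluing_surfaceMk hg).eq _ _ _ (arcGluing_arcStart (j, true))
  have hb' := (isGluing_surfaceMk hg).eq _ _ _ (arcGluing_arcStart_add_one (j, true))
  simp only [arcStart, Bool.toNat_false, Bool.toNat_true, add_zero, add_assoc, Nat.reduceAdd]
    at ha ha' hb hb'
  interval_cases i
  · exact ha'.trans (hb'.trans ha.symm)
  · exact ha'.symm
  · exact hb'.symm
  · exact hb.symm.trans (ha'.trans hb')

theorem surfaceMk_vertex (hg : 0 < g) (k : ℕ) :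
    surfaceMk g (boundaryPoint g k) = surfaceMk g (boundaryPoint g (0 : ℕ)) := by
  induction k with
  | zero => rfl
  | succ k ih => rw [surfaceMk_vertex_succ hg, ih]

/-- The loop given by the segment from the first vertex to the `k`-th vertex. -/
noncomputable def vertexLoop (hg : 0 < g) (k : ℕ) :
    FundamentalGroup (StandardSurface g) (surfaceMk g (boundaryPoint g (0 : ℕ))) :=
  gluingLoop (surfaceMk g) _ (surfaceMk_vertex hg k)

theorem gluingLoop_vertex (hg : 0 < g) (k l : ℕ)
    (h : surfaceMk g (boundaryPoint g k) = surfaceMk g (boundaryPoint g l)) :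
    gluingLoop (surfaceMk g) _ h = (vertexLoop hg l)⁻¹ * vertexLoop hg k := by
  rw [vertexLoop, vertexLoop, ← gluingLoop_symm, ← gluingLoop_trans]

theorem vertexLoop_zero (hg : 0 < g) : vertexLoop hg 0 = 1 :=
  gluingLoop_refl _ _

theorem vertexLoop_four_mul_self (hg : 0 < g) : vertexLoop hg (4 * g) = 1 :=
  gluingLoop_of_eq _ ((boundaryPoint_eq_iff hg).2 ⟨1, by push_cast; ring⟩)

/-- The loop which leaves the polygon at the `k`-th vertex and reenters it at the `(k + 3)`-rd one.
For `k = arcStart e` this is the loop crossing the side with label `e`. -/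
noncomputable def sideLoop (hg : 0 < g) (k : ℕ) :
    FundamentalGroup (StandardSurface g) (surfaceMk g (boundaryPoint g (0 : ℕ))) :=
  (vertexLoop hg (k + 3))⁻¹ * vertexLoop hg k

theorem gluingLoop_eq_sideLoop (hg : 0 < g) {e : Fin g × Bool} {z z' : 𝔻}
    (h : arcGluing g e z z') (hz : surfaceMk g z = surfaceMk g z') :
    gluingLoop (surfaceMk g) _ hz = sideLoop hg (arcStart e) := by
  have := continuous_boundaryPoint g
  obtain ⟨t, rfl, rfl⟩ := h
  rw [sideLoop, ← gluingLoop_vertex hg _ _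
    ((isGluing_surfaceMk hg).eq e _ _ (arcGluing_arcStart e))]
  exact (gluingLoop_eq_of_path (q := surfaceMk g) _
    { toFun := fun s => boundaryPoint g (arcStart e + (s * t : I))
      source' := by simp
      target' := by simp }
    { toFun := fun s => boundaryPoint g (arcStart e + 3 - (s * t : I))
      source' := by simp
      target' := by simp }
    (fun s => (isGluing_surfaceMk hg).eq e _ _ ⟨s * t, rfl, rfl⟩) _ _).symm

theorem sideLoop_arcStart (hg : 0 < g) (e : Fin g × Bool) :
    sideLoop hg (arcStart e) =
      (vertexLoop hg (arcStart e + 2))⁻¹ * vertexLoop hg (arcStart e + 1) := by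
  rw [← gluingLoop_vertex hg _ _ ((isGluing_surfaceMk hg).eq e _ _ (arcGluing_arcStart_add_one e)),
    gluingLoop_eq_sideLoop hg (arcGluing_arcStart_add_one e)]

theorem commutatorProd_sideLoop (hg : 0 < g) {j : ℕ} (hj : j ≤ g) :
    commutatorProd (fun j => (sideLoop hg (4 * j))⁻¹) (fun j => sideLoop hg (4 * j + 1)) j =
      vertexLoop hg (4 * j) := by
  induction j with
  | zero => exact (vertexLoop_zero hg).symm
  | succ j ih =>
    have ha : sideLoop hg (4 * j) =
        (vertexLoop hg (4 * j + 2))⁻¹ * vertexLoop hg (4 * j + 1) :=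
      sideLoop_arcStart hg (⟨j, hj⟩, false)
    have hb : sideLoop hg (4 * j + 1) =
        (vertexLoop hg (4 * j + 3))⁻¹ * vertexLoop hg (4 * j + 2) :=
      sideLoop_arcStart hg (⟨j, hj⟩, true)
    rw [commutatorProd_succ, ih (by omega), commutatorElement_def]
    nth_rewrite 1 [sideLoop]
    nth_rewrite 1 [hb]
    rw [ha, sideLoop, Nat.mul_add, mul_one]
    group

/-- The homomorphism from the surface group to the fundamental group of the surface which maps each
generator `b_(j + 1)` to the loop crossing the side `b_(j + 1)` of the polygon, and each generator
`a_(j + 1)` to the inverse of the loop crossing the side `a_(j + 1)`. -/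
noncomputable def surfaceGroupHom (hg : 0 < g) : SurfaceGroup g →*
    FundamentalGroup (StandardSurface g) (surfaceMk g (boundaryPoint g (0 : ℕ))) :=
  SurfaceGroup.lift _ _ ((commutatorProd_sideLoop hg le_rfl).trans (vertexLoop_four_mul_self hg))

theorem surfaceGroupHom_a (hg : 0 < g) (j : Fin g) :
    surfaceGroupHom hg (SurfaceGroup.a g j) = (sideLoop hg (arcStart (j, false)))⁻¹ :=
  SurfaceGroup.lift_a _ _ _ j

theorem surfaceGroupHom_b (hg : 0 < g) (j : Fin g) :
    surfaceGroupHom hg (SurfaceGroup.b g j) = sideLoop hg (arcStart (j, true)) :=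
  SurfaceGroup.lift_b _ _ _ j

theorem surfaceGroupHom_surjective (hg : 0 < g) : Function.Surjective (surfaceGroupHom hg) := by
  rw [← MonoidHom.range_eq_top]
  refine (isGluing_surfaceMk hg).eq_top_of_forall_gluingLoop_mem ?_ (exists_isCollapse hg)
  intro e z z' he hz
  rw [gluingLoop_eq_sideLoop hg he hz]
  obtain ⟨j, _ | _⟩ := e
  · rw [← Subgroup.inv_mem_iff, ← surfaceGroupHom_a]
    exact ⟨_, rfl⟩
  · rw [← surfaceGroupHom_b]
    exact ⟨_, rfl⟩

theorem surfaceGroupHom_injective (hg : 0 < g) : Function.Injective (surfaceGroupHom hg) := by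
  let _ : TopologicalSpace (SurfaceGroup g) := ⊥
  have _ : DiscreteTopology (SurfaceGroup g) := ⟨rfl⟩
  obtain ⟨Ω, M, Λ, hΛ, hM⟩ := (isGluing_surfaceMk hg).exists_monodromy
    (isGluingCochain_surfaceCochain hg (SurfaceGroup.commutatorProd_eq_one g))
    (boundaryPoint g (0 : ℕ))
  have hM_sideLoop (e : Fin g × Bool) (k : SurfaceGroup g) : M (sideLoop hg (arcStart e)) (Λ k) =
      Λ ((arcValue (SurfaceGroup.a g) (SurfaceGroup.b g) e)⁻¹ * k) := by
    rw [← gluingLoop_eq_sideLoop hg (arcGluing_arcStart e)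
      ((isGluing_surfaceMk hg).eq e _ _ (arcGluing_arcStart e))]
    exact hM e _ _ (arcGluing_arcStart e) _ k
  refine injective_of_perm_apply_eq (surfaceGroupHom hg) M hΛ
    (SurfaceGroup.closure_range_generators g) ?_
  rintro _ ⟨⟨j, _ | _⟩, rfl⟩ k
  · simp only [cond_false]
    rw [surfaceGroupHom_a, map_inv, Equiv.Perm.inv_eq_iff_eq, hM_sideLoop]
    simp [arcValue]
  · simp only [cond_true]
    rw [surfaceGroupHom_b, hM_sideLoop]
    simp [arcValue]

instance : PathConnectedSpace (StandardSurface g) :=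
  (Quot.mk_surjective (r := SideGluing g)).pathConnectedSpace continuous_quot_mk

/-- The inverse of `surfaceGroupHom`, transported to an arbitrary base point along some path. -/
noncomputable def fundamentalGroupStandardSurface (hg : 0 < g) (x : StandardSurface g) :
    FundamentalGroup (StandardSurface g) x ≃* SurfaceGroup g :=
  (FundamentalGroup.fundamentalGroupMulEquivOfPathConnected _ _).trans
    (MulEquiv.ofBijective (surfaceGroupHom hg)
      ⟨surfaceGroupHom_injective hg, surfaceGroupHom_surjective hg⟩).symm

theorem fundamentalGroup_map_injective_of_homotopyEquiv {X Y : Type*} [TopologicalSpace X]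
    [TopologicalSpace Y] (e : ContinuousMap.HomotopyEquiv X Y) (x : X) :
    Function.Injective (FundamentalGroup.map e.toFun x) :=
  (FundamentalGroupoidFunctor.equivOfHomotopyEquiv e).functor.map_injective

end SurfaceFundamentalGroup

theorem mainTheorem2_general (p : ℕ) [Fact p.Prime] (hp : p ≠ 2) {g : ℕ} (hg : 2 ≤ g)
    {X : Type*} [TopologicalSpace X] (hX : IsClosedSurfaceOfGenus g X) (x : X)
    (K : Type*) [Field K] [Algebra (ZMod p) K] (hK : 2 ≤ Algebra.trdeg (ZMod p) K) :
    ∃ φ : FundamentalGroup X x →* GL (Fin 2) K, Function.Injective φ := by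
  obtain ⟨e⟩ := hX
  obtain ⟨R, hR⟩ := exists_surfaceGroup_injective_GL p hp hg K hK
  let toSurfaceGroup := fundamentalGroupStandardSurface (zero_lt_two.trans_le hg) (e x)
  exact ⟨R.comp (toSurfaceGroup.toMonoidHom.comp (FundamentalGroup.map e.toHomotopyEquiv.toFun x)),
    hR.comp (toSurfaceGroup.injective.comp
      (fundamentalGroup_map_injective_of_homotopyEquiv e.toHomotopyEquiv x))⟩

theorem mainTheorem2 (p : ℕ) [Fact p.Prime] (hp : 5 ≤ p) (g : ℕ) (hg : 2 ≤ g)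
    (X : Type*) [TopologicalSpace X] (hX : IsClosedSurfaceOfGenus g X) (x : X)
    (K : Type*) [Field K] [CharP K p] [Algebra (ZMod p) K]
    (hK : 2 ≤ Algebra.trdeg (ZMod p) K) :
    ∃ (n : ℕ) (H : Subgroup (GL (Fin n) K)), Nonempty (H ≃* FundamentalGroup X x) := by
  obtain ⟨φ, hφ⟩ := mainTheorem2_general p (by omega) hg hX x K hK
  exact ⟨2, φ.range, ⟨(MonoidHom.ofInjective hφ).symm⟩⟩
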